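/- **Proposition.** Let $G$ be a connected, simply connected nilpotent Lie group with center $Z$ and Haar measure $dx$, and let $d\dot x$ be a Haar measure on $G/Z$. Let $(\pi,\mathcal H)$ be an irreducible (strongly continuous) unitary representation of $G$ that is square-integrable modulo the center, i.e., there is a constant $d_\pi>0$ such that $$\int_{G/Z}\langle f_1,\pi(\dot x)g_1\rangle\,\overline{\langle f_2,\pi(\dot x)g_2\rangle}\,d\dot x=d_\pi^{-1}\langle f_1,f_2\rangle\,\overline{\langle g_1,g_2\rangle}\qquad\text{for all } f_1,f_2,g_1,g_2\in\mathcal H,$$ where the integrand is integrable (it is well defined on $G/Z$, since $\pi|_Z$ is a multiple of the identity by a unitary character). Let $g\in\mathcal H$, $g\neq 0$, be a nice vector, i.e., $g=\pi(k)g_0=\int_G k(x)\pi(x)g_0\,dx$ for some $g_0\in\mathcal H$ and some continuous $k:G\to\mathbb C$ that has compact support or, more generally, belongs to the amalgam space $W(C,\ell^1)(G)$, i.e., $\int_G\sup_{q\in Q}|k(qx)|\,dx<\infty$ for some compact neighborhood $Q$ of the identity. Then there exists a quasi-lattice $\tilde\Lambda\subseteq G/Z$ such that for every $\Lambda\subseteq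 G$ that the projection $G\to G/Z$ maps bijectively onto $\tilde\Lambda$, the set $\mathcal G(g,\Lambda)=\{\pi(\lambda)g:\lambda\in\Lambda\}$ is a frame for $\mathcal H$: there are constants $A,B>0$ with $$A\|f\|^2\le\sum_{\lambda\in\Lambda}|\langle f,\pi(\lambda)g\rangle|^2\le B\|f\|^2\qquad\text{for all } f\in\mathcal H .$$ Here $\tilde\Lambda\subseteq G/Z$ is a quasi-lattice if there is a relatively compact set $K\subseteq G/Z$ (a fundamental domain) with $G/Z=\bigcup_{\lambda\in\tilde\Lambda}\lambda K$ and $\lambda K\cap\lambda'K=\emptyset$ for distinct $\lambda,\lambda'\in\tilde\Lambda$. -/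

import Mathlib

open MeasureTheory Set
open scoped ContDiff Manifold Topology Pointwise ComplexConjugate

noncomputable section

namespace CoherentFrame

variable {G : Type*} [Group G]
variable {H : Type*} [NormedAddCommGroup H] [InnerProductSpace ℂ H] [CompleteSpace H]

/-- Strong continuity of a homomorphism into the unitary group of `H`, i.e. `π` is a unitary
representation of the topological group `G`. -/
def IsStronglyContinuous [TopologicalSpace G] (π : G →* unitary (H →L[ℂ] H)) : Prop :=
  ∀ v : H, Continuous fun x : G => (π x : H →L[ℂ] H) v

/-- (Topological) irreducibility: `H` is nonzero and the only closed invariant subspaces are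
`0` and `H`. -/
def IsIrreducible (π : G →* unitary (H →L[ℂ] H)) : Prop :=
  Nontrivial H ∧
    ∀ W : Submodule ℂ H, IsClosed (W : Set H) →
      (∀ x : G, ∀ v ∈ W, (π x : H →L[ℂ] H) v ∈ W) → W = ⊥ ∨ W = ⊤

/-- The representation coefficient `V_g f (x) = ⟨f, π(x) g⟩`; here `⟨·,·⟩` is linear in the first
slot, while Mathlib's `inner` is linear in the second one. -/
def coeff (π : G →* unitary (H →L[ℂ] H)) (g f : H) (x : G) : ℂ :=
  inner ℂ ((π x : H →L[ℂ] H) g) f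

/-- Square-integrability modulo the center: for some formal dimension `d > 0`,
`∫_{G/Z} ⟨f₁, π(x) g₁⟩ conj ⟨f₂, π(x) g₂⟩ dx = d⁻¹ ⟨f₁, f₂⟩ conj ⟨g₁, g₂⟩` for all vectors,
where `ν` is Haar measure on `G/Z`. Since the center acts by unimodular scalars when `π` is
irreducible, the integrand does not depend on the representative `q.out` of the coset `q`. -/
def IsSquareIntegrableModCenter [TopologicalSpace G] [MeasurableSpace G]
    (ν : Measure (G ⧸ Subgroup.center G)) (π : G →* unitary (H →L[ℂ] H)) : Prop :=
  ∃ d : ℝ, 0 < d ∧ ∀ f₁ f₂ g₁ g₂ : H,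
    Integrable (fun q : G ⧸ Subgroup.center G =>
      coeff π g₁ f₁ q.out * conj (coeff π g₂ f₂ q.out)) ν ∧
    ∫ q : G ⧸ Subgroup.center G, coeff π g₁ f₁ q.out * conj (coeff π g₂ f₂ q.out) ∂ν =
      (d : ℂ)⁻¹ * inner ℂ f₂ f₁ * conj (inner ℂ g₂ g₁)

/-- The amalgam space `W(C, ℓ¹)(G)`: continuous functions whose local maximal function
`x ↦ sup_{q ∈ Q} |k (q x)|` is integrable, for some compact neighborhood `Q` of the identity. -/
def MemAmalgam [TopologicalSpace G] [MeasurableSpace G] (μ : Measure G) (k : G → ℂ) : Prop :=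
  Continuous k ∧ ∃ Q : Set G, IsCompact Q ∧ Q ∈ 𝓝 (1 : G) ∧
    ∫⁻ x, ⨆ q ∈ Q, ‖k (q * x)‖ₑ ∂μ < ⊤

/-- Nice vectors: `g = π(k) g₀ = ∫ k(x) π(x) g₀ dx` with `k` continuous of compact support or in
the amalgam space `W(C, ℓ¹)(G)`. -/
def IsNice [TopologicalSpace G] [MeasurableSpace G] (μ : Measure G)
    (π : G →* unitary (H →L[ℂ] H)) (g : H) : Prop :=
  ∃ (g₀ : H) (k : G → ℂ), ((Continuous k ∧ HasCompactSupport k) ∨ MemAmalgam μ k) ∧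
    g = ∫ x, k x • (π x : H →L[ℂ] H) g₀ ∂μ

/-- `Λ` is a quasi-lattice: there is a relatively compact fundamental domain `K` whose left
translates `λ K`, `λ ∈ Λ`, are pairwise disjoint and cover the group. -/
def IsQuasiLattice [TopologicalSpace G] (Λ : Set G) : Prop :=
  ∃ K : Set G, IsCompact (closure K) ∧ ⋃ l ∈ Λ, l • K = univ ∧
    ∀ l ∈ Λ, ∀ l' ∈ Λ, l ≠ l' → Disjoint (l • K) (l' • K)

/-- `{π(λ) g : λ ∈ Λ}` is a frame for `H`:
`A ‖f‖² ≤ ∑_{λ ∈ Λ} |⟨f, π(λ) g⟩|² ≤ B ‖f‖²` for all `f`, with constants `A, B > 0`. -/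
def IsCoherentFrame (π : G →* unitary (H →L[ℂ] H)) (g : H) (Λ : Set G) : Prop :=
  ∃ A B : ℝ, 0 < A ∧ 0 < B ∧ ∀ f : H,
    Summable (fun l : Λ => ‖coeff π g f l‖ ^ 2) ∧
    A * ‖f‖ ^ 2 ≤ ∑' l : Λ, ‖coeff π g f l‖ ^ 2 ∧
    ∑' l : Λ, ‖coeff π g f l‖ ^ 2 ≤ B * ‖f‖ ^ 2

end CoherentFrame

end

/-! Write `V f (x) = ⟨f, π(x) g⟩`. Square-integrability says that `‖V f‖² = d ‖f‖² ‖g‖²` in L² of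
`G/Z`, where `d` is the inverse formal dimension, so a frame inequality is a sampling inequality for
`|V f|`, which by Schur's lemma is a function on `G/Z`.

Since `g = π(k) g₀`, the change of `V f` under right translation by `u ∈ U` is at most the
coefficient `|⟨f, π(·) g₀⟩|` averaged against the oscillation of `k` (`enorm_coeff_sub_le`). The L²
norm of this error is at most the L¹ norm of the oscillation times `√d ‖f‖ ‖g₀‖`
(`lintegral_coeffOsc_sq_le`). As `k` lies in the amalgam space, a small `U` makes that L¹ norm as
small as desired (`MemAmalgam.exists_lintegral_leftOsc_lt`), and the squared error falls below a
quarter of `‖V f‖²`. Sampling on a set whose `U`-translates cover gives the lower bound; uniform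
separation gives the upper bound.

It remains to tile `G/Z` by translates of arbitrarily small sets
(`hasSmallTilings_quotient_center`). The adjoint representation is faithful on `G/Z`, and unipotent
because `G` is nilpotent. The subgroups acting trivially on successive terms of an invariant flag
form a chain, each being the kernel of an additive map from the next into a finite-dimensional
space. Tilings are lifted through this chain one real coordinate at a time
(`HasSmallTilings.of_ker_real`). -/

/-! ### Small tilings of locally compact unipotent groups. -/

noncomputable section SmallTilings

namespace CoherentFrame

section AdditiveMap

variable {B : Type*} [Group B] {A : Subgroup B} {M : Type*} [AddCommGroup M] {φ : B → M}

lemma map_one_of_additiveOn (hadd : ∀ x ∈ A, ∀ y ∈ A, φ (x * y) = φ x + φ y) : φ 1 = 0 := by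
  have := hadd 1 A.one_mem 1 A.one_mem
  simpa using this

lemma map_inv_of_additiveOn (hadd : ∀ x ∈ A, ∀ y ∈ A, φ (x * y) = φ x + φ y) {x : B}
    (hx : x ∈ A) : φ x⁻¹ = -φ x := by
  have := hadd x hx x⁻¹ (A.inv_mem hx)
  rw [mul_inv_cancel, map_one_of_additiveOn hadd] at this
  exact (neg_eq_of_add_eq_zero_right this.symm).symm

lemma map_pow_of_additiveOn (hadd : ∀ x ∈ A, ∀ y ∈ A, φ (x * y) = φ x + φ y) {x : B}
    (hx : x ∈ A) (n : ℕ) : φ (x ^ n) = n • φ x := by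
  induction n with
  | zero => simpa using map_one_of_additiveOn hadd
  | succ n ih => rw [pow_succ, hadd _ (A.pow_mem hx n) _ hx, ih, succ_nsmul]

end AdditiveMap

variable {B : Type*} [Group B] [TopologicalSpace B]

/-- The subgroup `A` can be tiled by left translates of arbitrarily small subsets, along a
uniformly separated set of translations. -/
def HasSmallTilings (A : Subgroup B) : Prop :=
  ∀ U ∈ 𝓝 (1 : B), ∃ Λ K : Set B, Λ ⊆ A ∧ K ⊆ A ∧ K ⊆ U ∧
    (∀ a ∈ A, ∃ l ∈ Λ, ∃ k ∈ K, l * k = a) ∧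
    (∀ l ∈ Λ, ∀ l' ∈ Λ, ∀ k ∈ K, ∀ k' ∈ K, l * k = l' * k' → l = l') ∧
    ∃ V ∈ 𝓝 (1 : B), ∀ l ∈ Λ, ∀ l' ∈ Λ, l⁻¹ * l' ∈ V → l = l'

lemma hasSmallTilings_bot : HasSmallTilings (⊥ : Subgroup B) := by
  intro U hU
  refine ⟨{1}, {1}, by simp, by simp, by simpa using mem_of_mem_nhds hU, ?_, ?_, univ, ?_, ?_⟩
  · intro a ha
    exact ⟨1, rfl, 1, rfl, by simpa using (Subgroup.mem_bot.1 ha).symm⟩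
  · rintro l rfl l' rfl _ _ _ _ _; rfl
  · exact Filter.univ_mem
  · rintro l rfl l' rfl _; rfl

variable {A A' : Subgroup B} {φ : B → ℝ}

/-- Lifts of `T` multiply the kernel's translations on the left and lifts of `S` multiply its tile
on the right, so the kernel factors meet in the middle and can be recombined there. Separation is
required through a neighbourhood in `B` rather than in `ℝ`, because the image of `φ` may be dense
while the kernel is open. -/
lemma HasSmallTilings.of_ker [IsTopologicalGroup B] (hA' : HasSmallTilings A')
    (hadd : ∀ x ∈ A, ∀ y ∈ A, φ (x * y) = φ x + φ y)
    (hker : ∀ x, x ∈ A' ↔ x ∈ A ∧ φ x = 0)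
    (hφ : ∀ U ∈ 𝓝 (1 : B), ∃ T S : Set ℝ, T ⊆ φ '' A ∧ S ⊆ φ '' (A ∩ U) ∧
      (∀ x ∈ A, ∃ t ∈ T, ∃ s ∈ S, t + s = φ x) ∧
      (∀ t ∈ T, ∀ t' ∈ T, ∀ s ∈ S, ∀ s' ∈ S, t + s = t' + s' → t = t') ∧
      ∃ V ∈ 𝓝 (1 : B), ∀ t ∈ T, ∀ t' ∈ T, ∀ v ∈ V, v ∈ A → φ v = t' - t → t = t') :
    HasSmallTilings A := by
  intro U hU
  obtain ⟨U₁, hU₁, hUU⟩ := exists_nhds_one_split hU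
  obtain ⟨Λ, K, hΛA, hKA, hKU, hex, huniq, V, hV, hsep⟩ := hA' U₁ hU₁
  obtain ⟨T, S, hT, hS, hex', huniq', V', hV', hsep'⟩ := hφ U₁ hU₁
  have hT' : ∀ t ∈ T, ∃ x, x ∈ A ∧ φ x = t := fun t ht => hT ht
  have hS' : ∀ s ∈ S, ∃ x, (x ∈ A ∧ x ∈ U₁) ∧ φ x = s := fun s hs => hS hs
  choose! σ hσA hσ using hT'
  choose! τ hτA hτ using hS'
  have hAA : ∀ x ∈ A', x ∈ A := fun x hx => ((hker x).1 hx).1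
  have h0 : ∀ x ∈ A', φ x = 0 := fun x hx => ((hker x).1 hx).2
  have hφl : ∀ t ∈ T, ∀ a ∈ A', φ (σ t * a) = t := fun t ht a ha => by
    rw [hadd _ (hσA t ht) _ (hAA a ha), hσ t ht, h0 a ha, add_zero]
  have hφr : ∀ s ∈ S, ∀ b ∈ A', φ (b * τ s) = s := fun s hs b hb => by
    rw [hadd _ (hAA b hb) _ (hτA s hs).1, hτ s hs, h0 b hb, zero_add]
  have hl : ∀ t ∈ T, ∀ a ∈ A', σ t * a ∈ A := fun t ht a ha => A.mul_mem (hσA t ht) (hAA a ha)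
  have hr : ∀ s ∈ S, ∀ b ∈ A', b * τ s ∈ A := fun s hs b hb =>
    A.mul_mem (hAA b hb) (hτA s hs).1
  refine ⟨{x | ∃ t ∈ T, ∃ a ∈ Λ, σ t * a = x}, {x | ∃ s ∈ S, ∃ b ∈ K, b * τ s = x},
    ?_, ?_, ?_, ?_, ?_, V ∩ V', Filter.inter_mem hV hV', ?_⟩
  · rintro _ ⟨t, ht, a, ha, rfl⟩
    exact hl t ht a (hΛA ha)
  · rintro _ ⟨s, hs, b, hb, rfl⟩
    exact hr s hs b (hKA hb)
  · rintro _ ⟨s, hs, b, hb, rfl⟩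
    exact hUU _ (hKU hb) _ (hτA s hs).2
  · intro x hx
    obtain ⟨t, ht, s, hs, hts⟩ := hex' x hx
    have hy : (σ t)⁻¹ * x * (τ s)⁻¹ ∈ A' := by
      have h1 : (σ t)⁻¹ * x ∈ A := A.mul_mem (A.inv_mem (hσA t ht)) hx
      refine (hker _).2 ⟨A.mul_mem h1 (A.inv_mem (hτA s hs).1), ?_⟩
      rw [hadd _ h1 _ (A.inv_mem (hτA s hs).1), hadd _ (A.inv_mem (hσA t ht)) _ hx,
        map_inv_of_additiveOn hadd (hσA t ht), map_inv_of_additiveOn hadd (hτA s hs).1, hσ t ht, hτ s hs,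
        ← hts]
      ring
    obtain ⟨a, ha, b, hb, hab⟩ := hex _ hy
    refine ⟨_, ⟨t, ht, a, ha, rfl⟩, _, ⟨s, hs, b, hb, rfl⟩, ?_⟩
    have : σ t * a * (b * τ s) = σ t * (a * b) * τ s := by group
    rw [this, hab]; group
  · rintro _ ⟨t, ht, a, ha, rfl⟩ _ ⟨t', ht', a', ha', rfl⟩ _ ⟨s, hs, b, hb, rfl⟩ _
      ⟨s', hs', b', hb', rfl⟩ h
    have h1 := congrArg φ h
    rw [hadd _ (hl t ht a (hΛA ha)) _ (hr s hs b (hKA hb)),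
      hadd _ (hl t' ht' a' (hΛA ha')) _ (hr s' hs' b' (hKA hb')),
      hφl t ht a (hΛA ha), hφl t' ht' a' (hΛA ha'), hφr s hs b (hKA hb),
      hφr s' hs' b' (hKA hb')] at h1
    obtain rfl := huniq' t ht t' ht' s hs s' hs' h1
    obtain rfl := add_left_cancel h1
    have h2 : a * b = a' * b' := by
      have h3 : σ t * (a * b) * τ s = σ t * (a' * b') * τ s := by
        simpa only [mul_assoc] using h
      exact mul_left_cancel (mul_right_cancel h3)
    rw [huniq a ha a' ha' b hb b' hb' h2]
  · rintro _ ⟨t, ht, a, ha, rfl⟩ _ ⟨t', ht', a', ha', rfl⟩ ⟨hv, hv'⟩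
    have h1 : φ ((σ t * a)⁻¹ * (σ t' * a')) = t' - t := by
      rw [hadd _ (A.inv_mem (hl t ht a (hΛA ha))) _ (hl t' ht' a' (hΛA ha')),
        map_inv_of_additiveOn hadd (hl t ht a (hΛA ha)), hφl t ht a (hΛA ha),
        hφl t' ht' a' (hΛA ha')]
      ring
    obtain rfl := hsep' t ht t' ht' _ hv'
      (A.mul_mem (A.inv_mem (hl t ht a (hΛA ha))) (hl t' ht' a' (hΛA ha'))) h1
    have h2 : (σ t * a)⁻¹ * (σ t * a') = a⁻¹ * a' := by group
    rw [h2] at hv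
    rw [hsep a ha a' ha' hv]

/-- A continuous homomorphism from a locally compact group to `ℝ` is open or has open kernel. -/
lemma open_or_ker_open [IsTopologicalGroup B] [LocallyCompactSpace B] [T2Space B]
    (hA : IsClosed (A : Set B)) (hc : Continuous φ)
    (hadd : ∀ x ∈ A, ∀ y ∈ A, φ (x * y) = φ x + φ y) :
    (∀ U ∈ 𝓝 (1 : B), ∃ ε > 0, ∀ t : ℝ, |t| < ε → ∃ x ∈ A, x ∈ U ∧ φ x = t) ∨
      ∃ V ∈ 𝓝 (1 : B), ∀ x ∈ V, x ∈ A → φ x = 0 := by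
  by_contra! hcon
  obtain ⟨⟨U, hU, hno⟩, hV⟩ := hcon
  have hφ1 : φ 1 = 0 := map_one_of_additiveOn hadd
  obtain ⟨U₁, hU₁, hUU⟩ := exists_nhds_one_split hU
  obtain ⟨W₀, hW₀, hW₀U, hW₀c⟩ := LocallyCompactSpace.local_compact_nhds 1 U₁ hU₁
  set W : Set B := W₀ ∩ W₀⁻¹ with hWdef
  have hWn : W ∈ 𝓝 (1 : B) := Filter.inter_mem hW₀ (inv_mem_nhds_one B hW₀)
  have hWc : IsCompact W := hW₀c.inter hW₀c.inv
  have h1W : (1 : B) ∈ W := mem_of_mem_nhds hWn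
  have hWinv : ∀ x ∈ W, x⁻¹ ∈ W := fun x hx => ⟨hx.2, by simpa using hx.1⟩
  have hWW : IsCompact ((A : Set B) ∩ (W * W)) := (hWc.mul hWc).inter_left hA
  -- Small values taken on `W * W` are already taken on `W`: off the open set `ker φ · int W`, the
  -- function `|φ|` has a positive minimum on the compact set `A ∩ W * W`.
  obtain ⟨ε, hε, hεW⟩ : ∃ ε > 0, ∀ x ∈ A, x ∈ W * W → |φ x| < ε →
      ∃ w ∈ A, w ∈ W ∧ φ w = φ x := by
    set O : Set B := ⋃ k ∈ {k : B | k ∈ A ∧ φ k = 0}, k • interior W with hO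
    have hOo : IsOpen O := isOpen_biUnion fun k _ => isOpen_interior.smul k
    have hmem : ∀ x ∈ A, x ∈ O → ∃ w ∈ A, w ∈ W ∧ φ w = φ x := by
      intro x hx hxO
      obtain ⟨k, ⟨hkA, hk⟩, hxk⟩ := mem_iUnion₂.1 hxO
      refine ⟨k⁻¹ * x, A.mul_mem (A.inv_mem hkA) hx,
        interior_subset (mem_smul_set_iff_inv_smul_mem.1 hxk), ?_⟩
      rw [hadd _ (A.inv_mem hkA) _ hx, map_inv_of_additiveOn hadd hkA, hk]; simp
    have hSc : IsCompact (((A : Set B) ∩ (W * W)) \ O) := hWW.diff hOo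
    rcases (((A : Set B) ∩ (W * W)) \ O).eq_empty_or_nonempty with he | hne
    · refine ⟨1, one_pos, fun x hx hxW _ => hmem x hx ?_⟩
      by_contra hxO
      exact (he ▸ (⟨⟨hx, hxW⟩, hxO⟩ : x ∈ ((A : Set B) ∩ (W * W)) \ O) : x ∈ (∅ : Set B))
    · obtain ⟨x₀, hx₀, hmin⟩ := hSc.exists_isMinOn hne (continuous_abs.comp hc).continuousOn
      refine ⟨|φ x₀|, abs_pos.2 fun h0 => hx₀.2 ?_, fun x hx hxW hlt => hmem x hx ?_⟩
      · refine mem_iUnion₂.2 ⟨x₀, ⟨hx₀.1.1, h0⟩, ?_⟩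
        exact ⟨1, mem_interior_iff_mem_nhds.2 hWn, by simp⟩
      · by_contra hxO
        exact absurd (isMinOn_iff.1 hmin x ⟨⟨hx, hxW⟩, hxO⟩) (not_le.2 hlt)
  obtain ⟨t, htε, ht⟩ := hno ε hε
  have hWWU : ∀ x ∈ W * W, x ∈ U := by
    rintro _ ⟨a, ha, b, hb, rfl⟩
    exact hUU _ (hW₀U ha.1) _ (hW₀U hb.1)
  have ht' : ∀ x ∈ A, x ∈ W * W → φ x ≠ t ∧ φ x ≠ -t := by
    intro x hx hxW
    refine ⟨ht x hx (hWWU x hxW), fun h => ?_⟩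
    obtain ⟨a, ha, b, hb, rfl⟩ := hxW
    refine ht (a * b)⁻¹ (A.inv_mem hx) (hWWU _ ?_) ?_
    · rw [mul_inv_rev]; exact mul_mem_mul (hWinv b hb) (hWinv a ha)
    · rw [map_inv_of_additiveOn hadd hx, h, neg_neg]
  have ht0 : 0 < |t| := by
    refine abs_pos.2 fun h => (ht' 1 A.one_mem ?_).1 (hφ1.trans h.symm)
    exact ⟨1, h1W, 1, h1W, by simp⟩
  have htabs : ∀ x ∈ A, x ∈ W * W → |φ x| ≠ |t| := by
    intro x hx hxW h
    rcases abs_eq_abs.1 h with h | h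
    exacts [(ht' x hx hxW).1 h, (ht' x hx hxW).2 h]
  -- The image of `A ∩ W * W` under `|φ|` is compact and misses `|t|`, so it misses an interval
  -- around `|t|`.
  obtain ⟨η, hη, hηW⟩ : ∃ η > 0, ∀ x ∈ A, x ∈ W * W → |φ x| < |t| + η → |φ x| < |t| := by
    have hcl : IsClosed ((fun x => |φ x|) '' ((A : Set B) ∩ (W * W))) :=
      (hWW.image (continuous_abs.comp hc)).isClosed
    have hnt : |t| ∉ (fun x => |φ x|) '' ((A : Set B) ∩ (W * W)) := by
      rintro ⟨x, ⟨hx, hxW⟩, h⟩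
      exact htabs x hx hxW h
    obtain ⟨η, hη, hball⟩ := Metric.isOpen_iff.1 hcl.isOpen_compl _ hnt
    refine ⟨η, hη, fun x hx hxW hlt => ?_⟩
    by_contra! hge
    refine hball (show |φ x| ∈ Metric.ball |t| η from ?_) ⟨x, ⟨hx, hxW⟩, rfl⟩
    rw [Metric.mem_ball, Real.dist_eq, abs_lt]
    constructor <;> linarith
  obtain ⟨b, ⟨hbW, hbη⟩, hbA, hb0⟩ := hV (W ∩ {x | |φ x| < η})
    (Filter.inter_mem hWn ((isOpen_lt (continuous_abs.comp hc) continuous_const).mem_nhds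
      (by simpa [hφ1] using hη)))
  -- Adding `φ b` is too short a step to jump the gap at `|t|`, and each sum is again attained in
  -- `W`. All multiples of `φ b ≠ 0` are then bounded by `|t|`, against the Archimedean property.
  have key : ∀ n : ℕ, ∃ w ∈ A, w ∈ W ∧ φ w = n * φ b ∧ |φ w| < |t| := by
    intro n
    induction n with
    | zero => exact ⟨1, A.one_mem, h1W, by simpa using hφ1, by simpa [hφ1] using ht0⟩
    | succ n ih =>
      obtain ⟨w, hwA, hwW, hw, hlt⟩ := ih
      have hm : w * b ∈ W * W := mul_mem_mul hwW hbW
      have hmA := A.mul_mem hwA hbA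
      have h1 : |φ (w * b)| < |t| := by
        refine hηW _ hmA hm ?_
        rw [hadd _ hwA _ hbA]
        exact (abs_add_le _ _).trans_lt (add_lt_add hlt hbη)
      obtain ⟨w', hw'A, hw'W, hw'⟩ := hεW _ hmA hm (h1.trans htε)
      refine ⟨w', hw'A, hw'W, ?_, by rwa [hw']⟩
      rw [hw', hadd _ hwA _ hbA, hw]; push_cast; ring
  obtain ⟨n, hn⟩ := exists_nat_gt (|t| / |φ b|)
  obtain ⟨w, -, -, hw, hlt⟩ := key n
  rw [hw, abs_mul, Nat.abs_cast] at hlt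
  rw [div_lt_iff₀ (abs_pos.2 hb0)] at hn
  exact lt_asymm hn hlt

lemma HasSmallTilings.of_ker_real [IsTopologicalGroup B] [LocallyCompactSpace B] [T2Space B]
    (hA' : HasSmallTilings A') (hA : IsClosed (A : Set B)) (hc : Continuous φ)
    (hadd : ∀ x ∈ A, ∀ y ∈ A, φ (x * y) = φ x + φ y)
    (hker : ∀ x, x ∈ A' ↔ x ∈ A ∧ φ x = 0) : HasSmallTilings A := by
  refine hA'.of_ker hadd hker fun U hU => ?_
  rcases open_or_ker_open hA hc hadd with h | ⟨V, hV, hV0⟩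
  · obtain ⟨ε, hε, hεU⟩ := h U hU
    have hsurj : ∀ t : ℝ, ∃ x ∈ A, φ x = t := by
      intro t
      obtain ⟨n, hn⟩ := exists_nat_gt (|t| / ε)
      have hn0 : (0 : ℝ) < n := (by positivity : (0 : ℝ) ≤ |t| / ε).trans_lt hn
      obtain ⟨x, hx, -, hxt⟩ := hεU (t / n) (by
        rw [abs_div, Nat.abs_cast, div_lt_iff₀ hn0]
        rwa [div_lt_iff₀ hε, mul_comm] at hn)
      refine ⟨x ^ n, A.pow_mem hx n, ?_⟩
      rw [map_pow_of_additiveOn hadd hx, hxt, nsmul_eq_mul]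
      field_simp
    have huniq : ∀ m n : ℤ, |(m : ℝ) * ε - n * ε| < ε → m = n := by
      intro m n h
      rw [← sub_mul, abs_mul, abs_of_pos hε] at h
      have h1 : |((m - n : ℤ) : ℝ)| < 1 := by
        push_cast; exact (mul_lt_iff_lt_one_left hε).1 h
      rw [← Int.cast_abs] at h1
      have h2 : |m - n| < 1 := by exact_mod_cast h1
      exact sub_eq_zero.1 (Int.abs_lt_one_iff.1 h2)
    -- Open case: `ℝ` is tiled by the translates of `[0, ε)` along `ε ℤ`.
    refine ⟨range fun n : ℤ => (n : ℝ) * ε, Ico 0 ε, ?_, ?_, ?_, ?_, {x | |φ x| < ε}, ?_, ?_⟩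
    · rintro t -
      exact hsurj t
    · rintro t ⟨ht0, htε⟩
      obtain ⟨x, hx, hxU, hxt⟩ := hεU t (by rwa [abs_of_nonneg ht0])
      exact ⟨x, ⟨hx, hxU⟩, hxt⟩
    · intro x _
      refine ⟨_, ⟨⌊φ x / ε⌋, rfl⟩, φ x - ⌊φ x / ε⌋ * ε, ⟨?_, ?_⟩, by ring⟩
      · have := Int.floor_le (φ x / ε)
        rw [le_div_iff₀ hε] at this
        linarith
      · have := Int.lt_floor_add_one (φ x / ε)
        rw [div_lt_iff₀ hε] at this
        linarith
    · rintro _ ⟨m, rfl⟩ _ ⟨n, rfl⟩ s hs s' hs' h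
      have : m = n := huniq m n (by
        rw [abs_lt]
        constructor <;> linarith [hs.1, hs.2, hs'.1, hs'.2])
      rw [this]
    · exact (isOpen_lt (continuous_abs.comp hc) continuous_const).mem_nhds
        (by simpa [map_one_of_additiveOn hadd] using hε)
    · rintro _ ⟨m, rfl⟩ _ ⟨n, rfl⟩ v hv _ h
      have : n = m := huniq n m (by rw [← h]; exact hv)
      rw [this]
  -- Open kernel: the cosets of the kernel are already separated, so the whole image serves as
  -- translations and a point as tile.
  · refine ⟨φ '' A, {0}, subset_rfl, ?_, ?_, ?_, V, hV, ?_⟩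
    · rintro _ rfl
      exact ⟨1, ⟨A.one_mem, mem_of_mem_nhds hU⟩, map_one_of_additiveOn hadd⟩
    · exact fun x hx => ⟨φ x, ⟨x, hx, rfl⟩, 0, rfl, add_zero _⟩
    · rintro t _ t' _ s rfl s' rfl h
      simpa using h
    · intro t _ t' _ v hv hvA h
      rw [hV0 v hv hvA] at h
      linarith

lemma HasSmallTilings.of_ker_finiteDimensional [IsTopologicalGroup B] [LocallyCompactSpace B]
    [T2Space B] {M : Type*} [NormedAddCommGroup M] [NormedSpace ℝ M] [FiniteDimensional ℝ M]
    {φ : B → M} (hA' : HasSmallTilings A') (hA : IsClosed (A : Set B)) (hc : Continuous φ)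
    (hadd : ∀ x ∈ A, ∀ y ∈ A, φ (x * y) = φ x + φ y)
    (hker : ∀ x, x ∈ A' ↔ x ∈ A ∧ φ x = 0) : HasSmallTilings A := by
  classical
  set e := (Module.finBasis ℝ M).equivFunL
  let N (s : Finset (Fin (Module.finrank ℝ M))) : Subgroup B :=
    { carrier := {x | x ∈ A ∧ ∀ i ∈ s, e (φ x) i = 0}
      one_mem' := ⟨A.one_mem, fun i _ => by simp [map_one_of_additiveOn hadd]⟩
      mul_mem' := fun {x y} hx hy => ⟨A.mul_mem hx.1 hy.1, fun i hi => by
        simp [hadd x hx.1 y hy.1, hx.2 i hi, hy.2 i hi]⟩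
      inv_mem' := fun {x} hx => ⟨A.inv_mem hx.1, fun i hi => by
        simp [map_inv_of_additiveOn hadd hx.1, hx.2 i hi]⟩ }
  have hci : ∀ i, Continuous fun x => e (φ x) i := fun i =>
    (continuous_apply i).comp (e.continuous.comp hc)
  -- Releasing the condition on one coordinate enlarges the subgroup by one real-valued additive
  -- map.
  have key : ∀ s, HasSmallTilings (N s) → HasSmallTilings A := by
    intro s
    induction s using Finset.induction_on with
    | empty =>
      intro h
      have : N ∅ = A := by ext x; exact ⟨fun hx => hx.1, fun hx => ⟨hx, by simp⟩⟩
      rwa [this] at h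
    | insert i s hi ih =>
      intro h
      refine ih (h.of_ker_real (φ := fun x => e (φ x) i) ?_ (hci i) ?_ ?_)
      · have : (N s : Set B) = (A : Set B) ∩ ⋂ i ∈ s, {x | e (φ x) i = 0} := by
          ext x
          simp only [mem_inter_iff, mem_iInter, mem_ofPred_eq]
          rfl
        rw [this]
        exact hA.inter (isClosed_biInter fun i _ => isClosed_eq (hci i) continuous_const)
      · intro x hx y hy
        simp [hadd x hx.1 y hy.1]
      · intro x
        change (x ∈ A ∧ ∀ j ∈ insert i s, _) ↔ (x ∈ A ∧ ∀ j ∈ s, _) ∧ _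
        rw [Finset.forall_mem_insert]
        tauto
  refine key Finset.univ ?_
  have : N Finset.univ = A' := by
    ext x
    rw [hker x]
    change (x ∈ A ∧ _) ↔ _
    refine and_congr_right fun _ => ?_
    rw [← e.map_eq_zero_iff]
    constructor
    · intro h; ext i; exact h i (Finset.mem_univ i)
    · intro h i _; rw [h]; rfl
  rwa [this]

/-- A locally compact group with a faithful continuous unipotent finite-dimensional
representation has arbitrarily small tilings. -/
lemma hasSmallTilings_top_of_unipotent [IsTopologicalGroup B] [LocallyCompactSpace B] [T2Space B]
    {E : Type*} [NormedAddCommGroup E] [NormedSpace ℝ E] [FiniteDimensional ℝ E]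
    (ρ : B →* (E →L[ℝ] E)) (hρ : Continuous ρ) (hinj : Function.Injective ρ)
    (W : ℕ → Submodule ℝ E) (h0 : W 0 = ⊤) {c : ℕ} (hcbot : W c = ⊥)
    (hanti : ∀ i, W (i + 1) ≤ W i) (hW : ∀ x i, ∀ w ∈ W i, ρ x w - w ∈ W (i + 1)) :
    HasSmallTilings (⊤ : Subgroup B) := by
  let N (i : ℕ) : Subgroup B :=
    { carrier := {x | ∀ w ∈ W i, ρ x w = w}
      one_mem' := fun w _ => by simp
      mul_mem' := fun {x y} hx hy w hw => by
        rw [map_mul, mul_apply_eq_comp, hy w hw, hx w hw]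
      inv_mem' := fun {x} hx w hw => by
        conv_lhs => rw [← hx w hw]
        rw [← mul_apply_eq_comp, ← map_mul]; simp }
  have hcl : ∀ i, IsClosed (N i : Set B) := by
    intro i
    have : (N i : Set B) = ⋂ w ∈ W i, {x | ρ x w = w} := by
      ext x; simp only [mem_iInter, mem_ofPred_eq]; rfl
    rw [this]
    exact isClosed_biInter fun w _ => isClosed_eq (hρ.clm_apply continuous_const) continuous_const
  have key : ∀ i, HasSmallTilings (N i) := by
    intro i
    induction i with
    | zero =>
      have : N 0 = ⊥ := by
        refine (Subgroup.eq_bot_iff_forall _).2 fun x hx => hinj ?_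
        ext w
        rw [map_one]
        exact hx w (h0 ▸ Submodule.mem_top)
      rw [this]
      exact hasSmallTilings_bot
    | succ i ih =>
      refine ih.of_ker_finiteDimensional (φ := fun x => (ρ x - 1).comp (W i).subtypeL)
        (hcl (i + 1)) ((hρ.sub continuous_const).clm_comp continuous_const) ?_ ?_
      · intro x hx y hy
        ext w
        -- Additivity comes from `ρ(xy) - 1 = ρ(x)(ρ(y) - 1) + (ρ(x) - 1)`: the vector `ρ(y) w - w`
        -- lies in `W (i + 1)`, which `x` fixes.
        have h1 := hx _ (hW y i w w.2)
        simp only [map_sub] at h1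
        simp only [ContinuousLinearMap.comp_apply, Submodule.subtypeL_apply,
          sub_apply, one_apply_eq_self,
          add_apply, map_mul, mul_apply_eq_comp]
        rw [sub_eq_iff_eq_add.1 h1]
        abel
      · intro x
        constructor
        · intro hx
          refine ⟨fun w hw => hx w (hanti i hw), ?_⟩
          ext w
          simp [hx w w.2]
        · rintro ⟨-, hx⟩ w hw
          have := congrArg (fun L => L ⟨w, hw⟩) hx
          simpa [sub_eq_zero] using this
  have : N c = ⊤ := by
    refine (Subgroup.eq_top_iff' _).2 fun x w hw => ?_
    rw [hcbot, Submodule.mem_bot] at hw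
    simp [hw]
  exact this ▸ key c

end CoherentFrame

end SmallTilings

/-! ### The adjoint representation and its unipotent flag. -/

noncomputable section Adjoint

open scoped commutatorElement

namespace CoherentFrame

variable {E : Type*} [NormedAddCommGroup E] [NormedSpace ℝ E]
  {G : Type*} [Group G] [TopologicalSpace G] [ChartedSpace E G]

/-- `f` fixes the identity and has derivative `L` there, in the preferred chart. -/
def HasDerivOne (f : G → G) (L : E →L[ℝ] E) : Prop :=
  f 1 = 1 ∧ ContinuousAt f 1 ∧
    HasFDerivAt (fun v => extChartAt 𝓘(ℝ, E) (1 : G) (f ((extChartAt 𝓘(ℝ, E) (1 : G)).symm v))) L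
      (extChartAt 𝓘(ℝ, E) (1 : G) 1)

local notation "chart" => extChartAt 𝓘(ℝ, E) (1 : G)

variable (E G) in
lemma chart_symm_one : (chart).symm (chart 1) = 1 :=
  extChartAt_to_inv (I := 𝓘(ℝ, E)) (1 : G)

variable (E G) in
lemma tendsto_chart_symm : Filter.Tendsto (chart).symm (𝓝 (chart 1)) (𝓝 1) := by
  have := continuousAt_extChartAt_symm (I := 𝓘(ℝ, E)) (1 : G)
  rwa [ContinuousAt, chart_symm_one E G] at this

variable (E) in
lemma one_mem_source : (1 : G) ∈ (chart).source := mem_extChartAt_source (I := 𝓘(ℝ, E)) 1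

variable (E) in
lemma eventually_chart_symm_chart {X : Type*} {l : Filter X} {f : X → G}
    (hf : Filter.Tendsto f l (𝓝 1)) : ∀ᶠ v in l, (chart).symm (chart (f v)) = f v := by
  filter_upwards [hf (extChartAt_source_mem_nhds (I := 𝓘(ℝ, E)) (1 : G))] with v hv
  exact (chart).left_inv hv

lemma HasDerivOne.id : HasDerivOne (fun x : G => x) (ContinuousLinearMap.id ℝ E) := by
  refine ⟨rfl, continuousAt_id, (hasFDerivAt_id _).congr_of_eventuallyEq ?_⟩
  filter_upwards [extChartAt_target_mem_nhds (I := 𝓘(ℝ, E)) (1 : G)] with v hv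
  exact (chart).right_inv hv

lemma HasDerivOne.comp {f g : G → G} {L M : E →L[ℝ] E} (hg : HasDerivOne g M)
    (hf : HasDerivOne f L) : HasDerivOne (fun x => g (f x)) (M.comp L) := by
  obtain ⟨hf1, hfc, hfd⟩ := hf
  obtain ⟨hg1, hgc, hgd⟩ := hg
  refine ⟨by simp only [hf1, hg1], ContinuousAt.comp (by rwa [hf1]) hfc, ?_⟩
  have h1 : chart (f ((chart).symm (chart 1))) = chart 1 := by rw [chart_symm_one E G, hf1]
  refine (HasFDerivAt.comp (chart 1) (h1.symm ▸ hgd) hfd).congr_of_eventuallyEq ?_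
  have hft : Filter.Tendsto (fun v => f ((chart).symm v)) (𝓝 (chart 1)) (𝓝 1) := by
    have := hfc.tendsto
    rw [hf1] at this
    exact this.comp (tendsto_chart_symm E G)
  filter_upwards [eventually_chart_symm_chart E hft] with v hv
  simp only [Function.comp_apply, hv]

lemma HasDerivOne.unique {f : G → G} {L M : E →L[ℝ] E} (h : HasDerivOne f L)
    (h' : HasDerivOne f M) : L = M := h.2.2.unique h'.2.2

lemma hasDerivOne_one : HasDerivOne (fun _ : G => (1 : G)) (0 : E →L[ℝ] E) :=
  ⟨rfl, continuousAt_const, hasFDerivAt_const _ _⟩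

variable [LieGroup 𝓘(ℝ, E) ∞ G]

lemma contMDiffAt_chart_symm {v : E} (hv : v ∈ (chart).target) :
    ContMDiffAt 𝓘(ℝ, E) 𝓘(ℝ, E) ∞ (chart).symm v :=
  (contMDiffOn_extChartAt_symm (1 : G)).contMDiffAt
    ((isOpen_extChartAt_target (I := 𝓘(ℝ, E)) (1 : G)).mem_nhds hv)

lemma contDiffAt_chart_comp {F : Type*} [NormedAddCommGroup F] [NormedSpace ℝ F] {f : F → G}
    {v : F} (hf : ContMDiffAt 𝓘(ℝ, F) 𝓘(ℝ, E) ∞ f v) (hv : f v ∈ (chart).source) :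
    ContDiffAt ℝ ∞ (fun v => chart (f v)) v := by
  rw [← contMDiffAt_iff_contDiffAt]
  rw [extChartAt_source] at hv
  exact ContMDiffAt.comp v (contMDiffAt_extChartAt' hv) hf

variable (E G) in
lemma contMDiffAt_fst_chart_symm :
    ContMDiffAt 𝓘(ℝ, E × E) 𝓘(ℝ, E) ∞ (fun p : E × E => (chart).symm p.1) (chart 1, chart 1) :=
  ContMDiffAt.comp (I' := 𝓘(ℝ, E)) _ (contMDiffAt_chart_symm (mem_extChartAt_target 1))
    (contMDiffAt_iff_contDiffAt.2 contDiffAt_fst)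

variable (E G) in
lemma contMDiffAt_snd_chart_symm :
    ContMDiffAt 𝓘(ℝ, E × E) 𝓘(ℝ, E) ∞ (fun p : E × E => (chart).symm p.2) (chart 1, chart 1) :=
  ContMDiffAt.comp (I' := 𝓘(ℝ, E)) _ (contMDiffAt_chart_symm (mem_extChartAt_target 1))
    (contMDiffAt_iff_contDiffAt.2 contDiffAt_snd)

variable (E G) in
-- A linear map on `E × E` is determined by its restrictions to the two axes, where multiplication
-- by `1` is the identity.
lemma hasFDerivAt_chart_mul :
    HasFDerivAt (fun p : E × E => chart ((chart).symm p.1 * (chart).symm p.2 : G))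
      (ContinuousLinearMap.fst ℝ E E + ContinuousLinearMap.snd ℝ E E) (chart 1, chart 1) := by
  have hmul : ContDiffAt ℝ ∞ (fun p : E × E => chart ((chart).symm p.1 * (chart).symm p.2 : G))
      (chart (1 : G), chart (1 : G)) := by
    refine contDiffAt_chart_comp ((contMDiffAt_fst_chart_symm E G).mul
      (contMDiffAt_snd_chart_symm E G)) ?_
    simpa only [Pi.mul_apply, chart_symm_one E G, mul_one] using one_mem_source E
  have hd := (hmul.differentiableAt (by simp)).hasFDerivAt
  have hid := (HasDerivOne.id (E := E) (G := G)).2.2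
  have h1 : HasFDerivAt (fun v : E => (v, chart (1 : G))) (ContinuousLinearMap.inl ℝ E E)
    (chart 1) := hasFDerivAt_prodMk_left _ _
  have h2 : HasFDerivAt (fun v : E => (chart (1 : G), v)) (ContinuousLinearMap.inr ℝ E E)
    (chart 1) := hasFDerivAt_prodMk_right _ _
  have h1' := HasFDerivAt.unique (f' := ContinuousLinearMap.id ℝ E)
    (by simpa only [Function.comp_def, chart_symm_one E G, mul_one] using hid)
    (HasFDerivAt.comp (chart (1 : G)) (f := fun v : E => (v, chart (1 : G))) hd h1)
  have h2' := HasFDerivAt.unique (f' := ContinuousLinearMap.id ℝ E)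
    (by simpa only [Function.comp_def, chart_symm_one E G, one_mul] using hid)
    (HasFDerivAt.comp (chart (1 : G)) (f := fun v : E => (chart (1 : G), v)) hd h2)
  refine hd.congr_fderiv (ContinuousLinearMap.ext fun p => ?_)
  have e1 := congrArg (fun T => T p.1) h1'
  have e2 := congrArg (fun T => T p.2) h2'
  simp only [ContinuousLinearMap.comp_apply, ContinuousLinearMap.inl_apply,
    ContinuousLinearMap.inr_apply, ContinuousLinearMap.id_apply] at e1 e2
  rw [show p = (p.1, 0) + (0, p.2) by simp, map_add _ (p.1, 0), map_add _ (p.1, 0), ← e1, ← e2]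
  simp

variable [IsTopologicalGroup G]

lemma HasDerivOne.mul {f g : G → G} {L M : E →L[ℝ] E} (hf : HasDerivOne f L)
    (hg : HasDerivOne g M) : HasDerivOne (fun x => f x * g x) (L + M) := by
  obtain ⟨hf1, hfc, hfd⟩ := hf
  obtain ⟨hg1, hgc, hgd⟩ := hg
  refine ⟨by simp only [hf1, hg1, one_mul], hfc.mul hgc, ?_⟩
  have h1 : chart (f ((chart).symm (chart 1))) = chart 1 := by rw [chart_symm_one E G, hf1]
  have h2 : chart (g ((chart).symm (chart 1))) = chart 1 := by rw [chart_symm_one E G, hg1]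
  have hm := hasFDerivAt_chart_mul E G
  have := HasFDerivAt.comp (chart 1) (f := fun v => (chart (f ((chart).symm v)),
    chart (g ((chart).symm v)))) (by rw [h1, h2]; exact hm) (hfd.prodMk hgd)
  have hL : (ContinuousLinearMap.fst ℝ E E + ContinuousLinearMap.snd ℝ E E).comp (L.prod M)
    = L + M := by ext v; simp
  rw [hL] at this
  refine this.congr_of_eventuallyEq ?_
  have hft : Filter.Tendsto (fun v => f ((chart).symm v)) (𝓝 (chart 1)) (𝓝 1) := by
    have := hfc.tendsto
    rw [hf1] at this
    exact this.comp (tendsto_chart_symm E G)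
  have hgt : Filter.Tendsto (fun v => g ((chart).symm v)) (𝓝 (chart 1)) (𝓝 1) := by
    have := hgc.tendsto
    rw [hg1] at this
    exact this.comp (tendsto_chart_symm E G)
  filter_upwards [eventually_chart_symm_chart E hft, eventually_chart_symm_chart E hgt]
    with v hv hv'
  simp only [Function.comp_apply, hv, hv']

omit [IsTopologicalGroup G] in
lemma hasDerivOne_of_contMDiff {f : G → G} (hf : ContMDiff 𝓘(ℝ, E) 𝓘(ℝ, E) ∞ f)
    (hf1 : f 1 = 1) : HasDerivOne f
      (fderiv ℝ (fun v => chart (f ((chart).symm v))) (chart 1)) := by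
  refine ⟨hf1, hf.continuous.continuousAt, ?_⟩
  refine ((contDiffAt_chart_comp (ContMDiffAt.comp (chart 1) hf.contMDiffAt
    (contMDiffAt_chart_symm (mem_extChartAt_target 1))) ?_).differentiableAt
      (by simp)).hasFDerivAt
  simpa only [Function.comp_apply, chart_symm_one E G, hf1] using one_mem_source E

lemma hasDerivOne_inv : HasDerivOne (fun x : G => x⁻¹) (-ContinuousLinearMap.id ℝ E) := by
  have h := hasDerivOne_of_contMDiff (contMDiff_inv 𝓘(ℝ, E) ∞ (G := G)) inv_one
  have h' := HasDerivOne.id.mul h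
  simp only [mul_inv_cancel] at h'
  rwa [eq_neg_of_add_eq_zero_right (h'.unique hasDerivOne_one)] at h

/-- The adjoint representation, in the chart at the identity. -/
def adjoint (x : G) : E →L[ℝ] E :=
  fderiv ℝ (fun v => chart (x * (chart).symm v * x⁻¹)) (chart 1)

omit [IsTopologicalGroup G] in
lemma hasDerivOne_conj (x : G) : HasDerivOne (fun y => x * y * x⁻¹) (adjoint (E := E) x) :=
  hasDerivOne_of_contMDiff ((contMDiff_const.mul contMDiff_id).mul contMDiff_const) (by simp)

lemma hasDerivOne_commutator (x : G) :
    HasDerivOne (fun y => x * y * x⁻¹ * y⁻¹) (adjoint x - ContinuousLinearMap.id ℝ E) := by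
  have := (hasDerivOne_conj (E := E) x).mul hasDerivOne_inv
  rwa [← sub_eq_add_neg] at this

variable (E G) in
/-- The adjoint representation as a homomorphism. -/
def adjointHom : G →* (E →L[ℝ] E) where
  toFun := adjoint
  map_one' := (hasDerivOne_conj 1).unique (by
    simp only [one_mul, inv_one, mul_one]
    exact HasDerivOne.id)
  map_mul' x y := (hasDerivOne_conj (x * y)).unique (by
    have := (hasDerivOne_conj (E := E) x).comp (hasDerivOne_conj y)
    simp only [mul_inv_rev, mul_assoc] at this ⊢
    exact this)

variable (E G) in
-- Near `1` the operator is a partial derivative of the smooth map `(u, v) ↦ u v u⁻¹` in the chart;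
-- the homomorphism property carries continuity from `1` to every point.
lemma continuous_adjointHom : Continuous (adjointHom E G) := by
  have key : ContinuousAt (adjointHom E G) 1 := by
    set Ψ : E × E → E := fun p =>
      chart ((chart).symm p.1 * (chart).symm p.2 * ((chart).symm p.1)⁻¹) with hΨ
    have hd : ContDiffAt ℝ ∞ Ψ (chart 1, chart 1) := by
      refine contDiffAt_chart_comp (((contMDiffAt_fst_chart_symm E G).mul
        (contMDiffAt_snd_chart_symm E G)).mul (contMDiffAt_fst_chart_symm E G).inv) ?_
      simpa only [chart_symm_one E G, mul_one, inv_one] using one_mem_source E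
    have hcont : ContinuousAt (fderiv ℝ Ψ) (chart 1, chart 1) :=
      (hd.fderiv_right (m := ∞) (by simp)).continuousAt
    have hev : ∀ᶠ p in 𝓝 (chart (1 : G), chart (1 : G)), DifferentiableAt ℝ Ψ p := by
      filter_upwards [(hd.of_le (m := 1) (by exact_mod_cast le_top)).eventually (by simp)] with p hp
      exact hp.differentiableAt (by simp)
    have ht : Filter.Tendsto (fun x : G => (chart x, chart (1 : G))) (𝓝 1)
        (𝓝 (chart 1, chart 1)) :=
      (continuousAt_extChartAt (I := 𝓘(ℝ, E)) (1 : G)).prodMk continuousAt_const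
    have heq : ∀ᶠ x : G in 𝓝 1, adjointHom E G x =
        (fderiv ℝ Ψ (chart x, chart 1)).comp (ContinuousLinearMap.inr ℝ E E) := by
      filter_upwards [ht.eventually hev, eventually_chart_symm_chart E Filter.tendsto_id]
        with x hx hxs
      have := (hx.hasFDerivAt.comp (chart 1)
        (hasFDerivAt_prodMk_right (𝕜 := ℝ) (chart x) (chart (1 : G)))).fderiv
      rw [← this]
      simp only [id_eq] at hxs
      simp only [hΨ, Function.comp_def, hxs]
      rfl
    refine ContinuousAt.congr ?_ (heq.mono fun _ h => h.symm)
    have hc2 : ContinuousAt (fun x : G => fderiv ℝ Ψ (chart x, chart 1)) 1 :=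
      ContinuousAt.comp (f := fun x : G => (chart x, chart (1 : G))) hcont ht
    exact hc2.clm_comp continuousAt_const
  refine continuous_iff_continuousAt.2 fun x₀ => ?_
  have h1 : ContinuousAt (fun y => adjointHom E G (x₀⁻¹ * y)) x₀ := by
    refine ContinuousAt.comp (by simpa using key) (by fun_prop)
  have h2 := (continuousAt_const (y := adjointHom E G x₀)).mul h1
  refine h2.congr (Filter.Eventually.of_forall fun y => ?_)
  simp only [Pi.mul_apply, ← map_mul, mul_inv_cancel_left]

/-- The commutator map with `x` has zero derivative near `1`, hence equals `1` there. The
centralizer of `x` is then an open subgroup, which is everything by connectedness. -/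
lemma mem_center_of_adjoint_eq_one [ConnectedSpace G] {x : G}
    (hx : adjoint x = ContinuousLinearMap.id ℝ E) : x ∈ Subgroup.center G := by
  set F : G → G := fun y => x * y * x⁻¹ * y⁻¹ with hF
  have hF0 : HasDerivOne F (0 : E →L[ℝ] E) := by
    have := hasDerivOne_commutator (E := E) x
    rwa [hx, sub_self] at this
  have hFc : Continuous F := by fun_prop
  have hmem : ∀ᶠ v in 𝓝 (chart (1 : G)), v ∈ (chart).target ∧
      F ((chart).symm v) ∈ (chart).source := by
    refine Filter.Eventually.and (extChartAt_target_mem_nhds (I := 𝓘(ℝ, E)) (1 : G)) ?_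
    have ht : Filter.Tendsto (fun v => F ((chart).symm v)) (𝓝 (chart 1)) (𝓝 1) := by
      have := hFc.tendsto 1
      rw [hF0.1] at this
      exact this.comp (tendsto_chart_symm E G)
    exact ht.eventually (extChartAt_source_mem_nhds (I := 𝓘(ℝ, E)) (1 : G))
  obtain ⟨r, hr, hball⟩ := Metric.eventually_nhds_iff_ball.1 hmem
  have hderiv : ∀ v ∈ Metric.ball (chart (1 : G)) r,
      HasFDerivAt (fun v => chart (F ((chart).symm v))) (0 : E →L[ℝ] E) v := by
    intro v₀ hv₀
    obtain ⟨hvt, hvs⟩ := hball v₀ hv₀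
    set y := (chart).symm v₀ with hy
    -- The identity `F z = x y x⁻¹ · F (y⁻¹ z) · y⁻¹` transports the vanishing derivative from `1`
    -- to `y`.
    have hκ : DifferentiableAt ℝ (fun v => chart (y⁻¹ * (chart).symm v)) v₀ := by
      refine (contDiffAt_chart_comp (contMDiffAt_const.mul
        (contMDiffAt_chart_symm hvt)) ?_).differentiableAt (by simp)
      simpa only [Pi.mul_apply, ← hy, inv_mul_cancel] using one_mem_source E
    have hτ : DifferentiableAt ℝ (fun w => chart (x * y * x⁻¹ * (chart).symm w * y⁻¹))
        (chart 1) := by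
      refine (contDiffAt_chart_comp ((contMDiffAt_const.mul
        (contMDiffAt_chart_symm (mem_extChartAt_target 1))).mul
        contMDiffAt_const) ?_).differentiableAt (by simp)
      simpa only [Pi.mul_apply, chart_symm_one E G, mul_one] using hvs
    have hκv : chart (y⁻¹ * (chart).symm v₀) = chart 1 := by rw [← hy, inv_mul_cancel]
    have h1 := HasFDerivAt.comp v₀ (hκv.symm ▸ hF0.2.2) hκ.hasFDerivAt
    have h2 : (fun v => chart (F ((chart).symm v))) (chart (y⁻¹ * (chart).symm v₀)) = chart 1 := by
      simp only [hκv, chart_symm_one E G, hF0.1]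
    have h3 := HasFDerivAt.comp v₀ (h2.symm ▸ hτ.hasFDerivAt) h1
    simp only [ContinuousLinearMap.zero_comp, ContinuousLinearMap.comp_zero] at h3
    refine h3.congr_of_eventuallyEq ?_
    have ht : Filter.Tendsto (fun v => y⁻¹ * (chart).symm v) (𝓝 v₀) (𝓝 1) := by
      have : ContinuousAt (fun v => y⁻¹ * (chart).symm v) v₀ :=
        continuousAt_const.mul (contMDiffAt_chart_symm hvt).continuousAt
      simpa only [ContinuousAt, ← hy, inv_mul_cancel] using this
    have hFt : Filter.Tendsto (fun v => F (y⁻¹ * (chart).symm v)) (𝓝 v₀) (𝓝 1) := by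
      have := hFc.tendsto 1
      rw [hF0.1] at this
      exact this.comp ht
    filter_upwards [eventually_chart_symm_chart E ht, eventually_chart_symm_chart E hFt]
      with v hv hv'
    simp only [Function.comp_apply, hv, hv']
    congr 1
    simp only [hF]
    group
  have hconst : ∀ v ∈ Metric.ball (chart (1 : G)) r, F ((chart).symm v) = 1 := by
    intro v hv
    have := Metric.isOpen_ball.is_const_of_fderiv_eq_zero
      (convex_ball (chart (1 : G)) r).isPreconnected
      (fun v hv => (hderiv v hv).differentiableAt.differentiableWithinAt)
      (fun v hv => (hderiv v hv).fderiv) hv (Metric.mem_ball_self hr)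
    simp only [chart_symm_one E G, hF0.1] at this
    exact (chart).injOn (hball v hv).2 (one_mem_source E) this
  set C : Subgroup G := Subgroup.centralizer {x} with hC
  have hCn : (C : Set G) ∈ 𝓝 (1 : G) := by
    filter_upwards [(continuousAt_extChartAt (I := 𝓘(ℝ, E)) (1 : G)).eventually
      (Metric.ball_mem_nhds _ hr), eventually_chart_symm_chart E Filter.tendsto_id] with y hy hy'
    have := hconst _ hy
    simp only [id_eq] at hy'
    rw [hy'] at this
    refine Subgroup.mem_centralizer_singleton_iff.2 ?_
    simp only [hF] at this
    rw [mul_inv_eq_one, mul_inv_eq_iff_eq_mul] at this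
    exact this.symm
  have hCo : IsOpen (C : Set G) := C.isOpen_of_mem_nhds hCn
  have hCu : (C : Set G) = univ :=
    IsClopen.eq_univ ⟨C.isClosed_of_isOpen hCo, hCo⟩ ⟨1, C.one_mem⟩
  refine Subgroup.mem_center_iff.2 fun y => ?_
  have : y ∈ (C : Set G) := hCu ▸ mem_univ y
  exact Subgroup.mem_centralizer_singleton_iff.1 this

variable (E G) in
/-- Span of the ranges of the derivatives at `1` of maps into the `i`-th term of the lower central
series. -/
def lcsTangent (i : ℕ) : Submodule ℝ E :=
  Submodule.span ℝ {w | ∃ (f : G → G) (L : E →L[ℝ] E) (v : E),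
    HasDerivOne f L ∧ (∀ y, f y ∈ (⊤ : Subgroup G).lowerCentralSeries i) ∧ L v = w}

/-- If `f` takes values in the `i`-th term and has derivative `L`, then `y ↦ x f(y) x⁻¹ f(y)⁻¹`
takes values in the next term and has derivative `(Ad x - 1) L`. This is the unipotence of the
adjoint action. -/
lemma adjoint_sub_mem_lcsTangent (x : G) (i : ℕ) {w : E} (hw : w ∈ lcsTangent E G i) :
    adjoint x w - w ∈ lcsTangent E G (i + 1) := by
  have hle : lcsTangent E G i ≤ (lcsTangent E G (i + 1)).comap
      ((adjoint x - ContinuousLinearMap.id ℝ E : E →L[ℝ] E) : E →ₗ[ℝ] E) := by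
    refine Submodule.span_le.2 ?_
    rintro _ ⟨f, L, v, hf, hfi, rfl⟩
    refine Submodule.subset_span ⟨_, _, v, (hasDerivOne_commutator x).comp hf, fun y => ?_, rfl⟩
    rw [Subgroup.lowerCentralSeries_succ]
    have : x * f y * x⁻¹ * (f y)⁻¹ = ⁅f y, x⁆⁻¹ := by rw [commutatorElement_inv]; rfl
    rw [this]
    exact Subgroup.inv_mem _ (Subgroup.commutator_mem_commutator (hfi y) (Subgroup.mem_top x))
  exact hle hw

/-- The quotient of a connected nilpotent Lie group by its center has arbitrarily small tilings. -/
lemma hasSmallTilings_quotient_center [FiniteDimensional ℝ E] [ConnectedSpace G]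
    [LocallyCompactSpace G] [T2Space G] [Group.IsNilpotent G] :
    HasSmallTilings (⊤ : Subgroup (G ⧸ Subgroup.center G)) := by
  have hclosed : IsClosed (Subgroup.center G : Set G) := by
    rw [← Subgroup.centralizer_univ]
    exact Set.isClosed_centralizer _
  have : T2Space (G ⧸ Subgroup.center G) := by
    have := hclosed
    infer_instance
  have hker : ∀ x ∈ Subgroup.center G, adjointHom E G x = 1 := by
    intro x hx
    refine (hasDerivOne_conj x).unique ?_
    have : (fun y => x * y * x⁻¹) = fun y : G => y := by
      funext y
      rw [← Subgroup.mem_center_iff.1 hx y, mul_inv_cancel_right]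
    rw [this]
    exact HasDerivOne.id
  let ρ : G ⧸ Subgroup.center G →* (E →L[ℝ] E) :=
    QuotientGroup.lift _ (adjointHom E G) hker
  have hρ : Continuous ρ :=
    (QuotientGroup.isQuotientMap_mk (Subgroup.center G)).continuous_iff.2 (continuous_adjointHom E G)
  have hinj : Function.Injective ρ := by
    refine (injective_iff_map_eq_one ρ).2 fun q hq => ?_
    induction q using QuotientGroup.induction_on with
    | H x => exact (QuotientGroup.eq_one_iff x).2 (mem_center_of_adjoint_eq_one hq)
  obtain ⟨c, hc⟩ := Subgroup.nilpotent_iff_lowerCentralSeries.1 ‹Group.IsNilpotent G›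
  refine hasSmallTilings_top_of_unipotent ρ hρ hinj (lcsTangent E G) ?_ (c := c) ?_ ?_ ?_
  · refine (Submodule.eq_top_iff').2 fun w => Submodule.subset_span
      ⟨_, _, w, HasDerivOne.id, fun y => ?_, rfl⟩
    simp
  · refine Submodule.span_eq_bot.2 ?_
    rintro _ ⟨f, L, v, hf, hfc, rfl⟩
    have : f = fun _ => 1 := by
      funext y
      have := hfc y
      rwa [hc, Subgroup.mem_bot] at this
    subst this
    rw [hf.unique hasDerivOne_one]
    rfl
  · intro i
    refine Submodule.span_mono ?_
    rintro _ ⟨f, L, v, hf, hfc, rfl⟩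
    exact ⟨f, L, v, hf, fun y => Subgroup.lowerCentralSeries_antitone _ (Nat.le_succ i) (hfc y), rfl⟩
  · intro q i w hw
    induction q using QuotientGroup.induction_on with
    | H x => exact adjoint_sub_mem_lcsTangent x i hw

end CoherentFrame

end Adjoint

/-! ### Representation coefficients on `G/Z` and their oscillation. -/

noncomputable section Coefficients

open scoped ENNReal

namespace CoherentFrame

variable {G : Type*} [Group G]
variable {H : Type*} [NormedAddCommGroup H] [InnerProductSpace ℂ H] [CompleteSpace H]

/-- Schur's lemma. -/
lemma IsIrreducible.exists_smul_of_mem_center {π : G →* unitary (H →L[ℂ] H)}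
    (hπ : IsIrreducible π) {z : G} (hz : z ∈ Subgroup.center G) :
    ∃ c : ℂ, ∀ v, (π z : H →L[ℂ] H) v = c • v := by
  have := hπ.1
  set T : H →L[ℂ] H := (π z : H →L[ℂ] H) with hT
  have hnormal : IsStarNormal T := by
    refine ⟨?_⟩
    have h := (π z).2
    rw [Unitary.mem_iff] at h
    exact h.1.trans h.2.symm
  have hcomm : ∀ x : G, Commute T (π x : H →L[ℂ] H) := by
    intro x
    have : π z * π x = π x * π z := by
      rw [← map_mul, ← map_mul, Subgroup.mem_center_iff.1 hz x]
    exact congrArg Subtype.val this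
  have hcomm' : ∀ x : G, Commute (star T) (π x : H →L[ℂ] H) := by
    intro x
    have hz' : z⁻¹ ∈ Subgroup.center G := Subgroup.inv_mem _ hz
    have hstar : (star T : H →L[ℂ] H) = (π z⁻¹ : H →L[ℂ] H) := by
      rw [map_inv]; rfl
    have : π z⁻¹ * π x = π x * π z⁻¹ := by
      rw [← map_mul, ← map_mul, Subgroup.mem_center_iff.1 hz' x]
    rw [hstar]
    exact congrArg Subtype.val this
  -- Functions of `T` commute with the representation, so their kernels are closed invariant
  -- subspaces.
  have hker : ∀ f : ℂ → ℂ, (cfc f T).ker = ⊥ ∨ (cfc f T).ker = ⊤ := by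
    intro f
    refine hπ.2 _ (cfc f T).isClosed_ker fun x v hv => ?_
    have hc := (hcomm x).cfc (hcomm' x) f
    have h1 : cfc f T ((π x : H →L[ℂ] H) v) = (π x : H →L[ℂ] H) (cfc f T v) :=
      congrArg (fun S : H →L[ℂ] H => S v) hc
    have hv' : cfc f T v = 0 := hv
    change cfc f T ((π x : H →L[ℂ] H) v) = 0
    rw [h1, hv', map_zero]
  have hne : ∀ f : ℂ → ℂ, Continuous f → ∀ a ∈ spectrum ℂ T, f a ≠ 0 → cfc f T ≠ 0 := by
    intro f hf a ha hfa h0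
    have h1 : f a ∈ spectrum ℂ (cfc f T) := by
      rw [cfc_map_spectrum f T hnormal hf.continuousOn]
      exact ⟨a, ha, rfl⟩
    rw [h0, spectrum.zero_eq] at h1
    exact hfa h1
  obtain ⟨c, hc⟩ := spectrum.nonempty (a := T)
  have hsub : ∀ b ∈ spectrum ℂ T, b = c := by
    intro b hb
    by_contra hbc
    -- Tents of this radius at `b` and `c` have product zero, yet each gives a nonzero operator; the
    -- kernel of one would be neither `⊥` nor `⊤`.
    set r : ℝ := dist b c / 2 with hr
    have hr0 : 0 < r := half_pos (dist_pos.2 hbc)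
    let p (a : ℂ) : ℂ → ℂ := fun w => ((max 0 (r - dist w a) : ℝ) : ℂ)
    have hpc : ∀ a, Continuous (p a) := fun a => by fun_prop
    have hpa : ∀ a, p a a ≠ 0 := fun a => by
      simp only [p, dist_self, sub_zero, max_eq_right hr0.le]
      exact_mod_cast hr0.ne'
    have hmul : cfc (p c) T * cfc (p b) T = 0 := by
      rw [← cfc_mul (p c) (p b) T (hpc c).continuousOn (hpc b).continuousOn]
      have : (fun w => p c w * p b w) = fun _ => 0 := by
        funext w
        simp only [p]
        rw [← Complex.ofReal_mul]
        norm_cast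
        rcases le_total r (dist w c) with h | h
        · rw [max_eq_left (by linarith), zero_mul]
        · have : dist b c ≤ dist w b + dist w c := dist_triangle_left _ _ _
          rw [max_eq_left (b := r - dist w b) (by linarith), mul_zero]
      rw [this, cfc_const_zero]
    have hfc := hne _ (hpc c) c hc (hpa c)
    have hfb := hne _ (hpc b) b hb (hpa b)
    rcases hker (p c) with h | h
    · refine hfb (ContinuousLinearMap.ext fun v => ?_)
      have h1 : cfc (p b) T v ∈ (cfc (p c) T).ker :=
        congrArg (fun S : H →L[ℂ] H => S v) hmul
      rw [h] at h1
      exact h1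
    · refine hfc (ContinuousLinearMap.ext fun v => ?_)
      have h1 : v ∈ (cfc (p c) T).ker := h ▸ Submodule.mem_top
      exact h1
  refine ⟨c, fun v => ?_⟩
  have h1 : T = algebraMap ℂ (H →L[ℂ] H) c := by
    conv_lhs => rw [← cfc_id' ℂ T hnormal]
    rw [cfc_congr (g := fun _ => c) (fun b hb => hsub b hb), cfc_const c T hnormal]
  rw [h1]
  rfl

lemma norm_unitary_apply (u : unitary (H →L[ℂ] H)) (v : H) : ‖(u : H →L[ℂ] H) v‖ = ‖v‖ :=
  (Unitary.linearIsometryEquiv u).norm_map v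

lemma coeff_mul (π : G →* unitary (H →L[ℂ] H)) (g f : H) (x y : G) :
    coeff π g f (x * y) = coeff π ((π y : H →L[ℂ] H) g) f x := by
  simp only [coeff, map_mul]
  rfl

lemma IsIrreducible.enorm_coeff_mul {π : G →* unitary (H →L[ℂ] H)} (hπ : IsIrreducible π)
    (g f : H) (x : G) {z : G} (hz : z ∈ Subgroup.center G) :
    ‖coeff π g f (x * z)‖ₑ = ‖coeff π g f x‖ₑ := by
  obtain ⟨c, hc⟩ := hπ.exists_smul_of_mem_center hz
  rcases eq_or_ne g 0 with rfl | hg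
  · simp [coeff]
  have h1 : ‖c‖ = 1 := by
    have h2 := norm_unitary_apply (π z) g
    rw [hc, norm_smul] at h2
    exact mul_right_cancel₀ (norm_ne_zero_iff.2 hg) (h2.trans (one_mul _).symm)
  rw [coeff_mul, hc]
  simp only [coeff, map_smul, inner_smul_left, enorm_mul]
  rw [enorm_eq_nnnorm (conj c)]
  have : ‖conj c‖₊ = 1 := by ext; simpa using h1
  rw [this]; simp

/-- Absolute value of a representation coefficient, as a function on `G / Z`. -/
def absCoeff (π : G →* unitary (H →L[ℂ] H)) (g f : H) (q : G ⧸ Subgroup.center G) : ℝ≥0∞ :=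
  ‖coeff π g f q.out‖ₑ

lemma IsIrreducible.absCoeff_mk {π : G →* unitary (H →L[ℂ] H)} (hπ : IsIrreducible π)
    (g f : H) (x : G) : absCoeff π g f (x : G ⧸ Subgroup.center G) = ‖coeff π g f x‖ₑ := by
  obtain ⟨z, hz⟩ := QuotientGroup.mk_out_eq_mul (Subgroup.center G) x
  rw [absCoeff, hz, hπ.enorm_coeff_mul g f x z.2]

lemma IsIrreducible.absCoeff_mul_mk {π : G →* unitary (H →L[ℂ] H)} (hπ : IsIrreducible π)
    (g f : H) (q : G ⧸ Subgroup.center G) (y : G) :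
    absCoeff π g f (q * (y : G ⧸ Subgroup.center G)) =
      absCoeff π ((π y : H →L[ℂ] H) g) f q := by
  induction q using QuotientGroup.induction_on with
  | H x => rw [← QuotientGroup.mk_mul, hπ.absCoeff_mk, hπ.absCoeff_mk, coeff_mul]

variable [TopologicalSpace G]

lemma IsStronglyContinuous.continuous_coeff {π : G →* unitary (H →L[ℂ] H)}
    (hc : IsStronglyContinuous π) (g f : H) : Continuous (coeff π g f) :=
  (hc g).inner continuous_const

lemma continuous_absCoeff {π : G →* unitary (H →L[ℂ] H)}
    (hc : IsStronglyContinuous π) (hπ : IsIrreducible π) (g f : H) :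
    Continuous (absCoeff π g f) := by
  refine (QuotientGroup.isQuotientMap_mk (Subgroup.center G)).continuous_iff.2 ?_
  have : absCoeff π g f ∘ (QuotientGroup.mk : G → G ⧸ Subgroup.center G) =
      fun x => ‖coeff π g f x‖ₑ := funext fun x => hπ.absCoeff_mk g f x
  rw [this]
  exact (hc.continuous_coeff g f).enorm

variable [MeasurableSpace G]

lemma IsSquareIntegrableModCenter.exists_lintegral_absCoeff_sq
    {ν : Measure (G ⧸ Subgroup.center G)} {π : G →* unitary (H →L[ℂ] H)}
    (h : IsSquareIntegrableModCenter ν π) :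
    ∃ d : ℝ, 0 < d ∧ ∀ g f : H,
      ∫⁻ q, absCoeff π g f q ^ 2 ∂ν = ENNReal.ofReal (d * ‖f‖ ^ 2 * ‖g‖ ^ 2) := by
  obtain ⟨d, hd, h⟩ := h
  -- From here on the constant is the inverse of the formal dimension.
  refine ⟨d⁻¹, inv_pos.2 hd, fun g f => ?_⟩
  obtain ⟨hi, he⟩ := h f f g g
  have h1 : ∀ q : G ⧸ Subgroup.center G, coeff π g f q.out * conj (coeff π g f q.out) =
      ((‖coeff π g f q.out‖ ^ 2 : ℝ) : ℂ) := fun q => by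
    rw [Complex.mul_conj, Complex.normSq_eq_norm_sq]
  simp only [h1] at hi he
  rw [integral_complex_ofReal, inner_self_eq_norm_sq_to_K, inner_self_eq_norm_sq_to_K] at he
  have h2 : ∫ q : G ⧸ Subgroup.center G, ‖coeff π g f q.out‖ ^ 2 ∂ν =
      d⁻¹ * ‖f‖ ^ 2 * ‖g‖ ^ 2 := by
    have : ((∫ q : G ⧸ Subgroup.center G, ‖coeff π g f q.out‖ ^ 2 ∂ν : ℝ) : ℂ) =
      ((d⁻¹ * ‖f‖ ^ 2 * ‖g‖ ^ 2 : ℝ) : ℂ) := by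
      rw [he]; simp
    exact_mod_cast this
  have hi' : Integrable (fun q : G ⧸ Subgroup.center G => ‖coeff π g f q.out‖ ^ 2) ν := by
    have := hi.re
    simpa only [Complex.ofReal_re, RCLike.re_eq_complex_re] using this
  rw [← h2, ofReal_integral_eq_lintegral_ofReal hi' (Filter.Eventually.of_forall fun q => by
    positivity)]
  refine lintegral_congr fun q => ?_
  rw [absCoeff, ENNReal.ofReal_pow (norm_nonneg _), ofReal_norm]

section Oscillation

/-- Left oscillation `y ↦ sup_{u ∈ U} |k y - k (u⁻¹ y)|`. -/
def leftOsc (k : G → ℂ) (U : Set G) (y : G) : ℝ≥0∞ := ⨆ u ∈ U, ‖k y - k (u⁻¹ * y)‖ₑ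

omit [TopologicalSpace G] [MeasurableSpace G] in
lemma leftOsc_mono {k : G → ℂ} {U V : Set G} (h : U ⊆ V) (y : G) :
    leftOsc k U y ≤ leftOsc k V y := biSup_mono h

variable [IsTopologicalGroup G] [BorelSpace G]

/-- The supremum may be uncountable, but a supremum of continuous functions is lower semicontinuous.
-/
lemma measurable_leftOsc {k : G → ℂ} (hk : Continuous k) (U : Set G) :
    Measurable (leftOsc k U) := by
  refine LowerSemicontinuous.measurable (lowerSemicontinuous_biSup fun u _ => ?_)
  exact Continuous.lowerSemicontinuous (by fun_prop)

omit [BorelSpace G] in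
lemma memAmalgam_of_hasCompactSupport [LocallyCompactSpace G] {μ : Measure G}
    [IsFiniteMeasureOnCompacts μ] {k : G → ℂ} (hk : Continuous k) (hks : HasCompactSupport k) :
    MemAmalgam μ k := by
  obtain ⟨Q, hQc, hQ⟩ := exists_compact_mem_nhds (1 : G)
  refine ⟨hk, Q, hQc, hQ, ?_⟩
  obtain ⟨C, hC⟩ := hk.bounded_above_of_compact_support hks
  have hK : IsCompact (Q⁻¹ * tsupport k) := hQc.inv.mul hks
  calc ∫⁻ x, ⨆ q ∈ Q, ‖k (q * x)‖ₑ ∂μ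
      ≤ ∫⁻ x, (toMeasurable μ (Q⁻¹ * tsupport k)).indicator
          (fun _ => ENNReal.ofReal C) x ∂μ := by
        refine lintegral_mono fun x => iSup₂_le fun q hq => ?_
        by_cases hx : k (q * x) = 0
        · simp [hx]
        · have hmem : x ∈ toMeasurable μ (Q⁻¹ * tsupport k) := by
            refine subset_toMeasurable _ _ ⟨q⁻¹, inv_mem_inv.2 hq, q * x,
              subset_tsupport _ hx, by simp⟩
          rw [indicator_of_mem hmem, ← ofReal_norm]
          exact ENNReal.ofReal_le_ofReal (hC _)
    _ = ENNReal.ofReal C * μ (Q⁻¹ * tsupport k) := by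
        rw [lintegral_indicator_const (measurableSet_toMeasurable _ _), measure_toMeasurable]
    _ < ⊤ := ENNReal.mul_lt_top ENNReal.ofReal_lt_top hK.measure_lt_top

omit [IsTopologicalGroup G] in
lemma MemAmalgam.integrable {μ : Measure G} {k : G → ℂ} [SecondCountableTopology G]
    (hk : MemAmalgam μ k) : Integrable k μ := by
  obtain ⟨hc, Q, -, hQ, hfin⟩ := hk
  refine ⟨hc.aestronglyMeasurable, lt_of_le_of_lt (lintegral_mono fun x => ?_) hfin⟩
  have := le_iSup₂ (f := fun (q : G) (_ : q ∈ Q) => ‖k (q * x)‖ₑ) 1 (mem_of_mem_nhds hQ)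
  simpa using this

/-- Dominated convergence along a countable neighbourhood basis: continuity of `k` gives pointwise
decay, and twice the local maximal function dominates once `U⁻¹ ⊆ Q`. -/
lemma MemAmalgam.exists_lintegral_leftOsc_lt [FirstCountableTopology G] {μ : Measure G}
    {k : G → ℂ} (hk : MemAmalgam μ k) {ε : ℝ≥0∞} (hε : 0 < ε) :
    ∃ U ∈ 𝓝 (1 : G), ∫⁻ y, leftOsc k U y ∂μ < ε := by
  obtain ⟨hc, Q, -, hQ, hfin⟩ := hk
  obtain ⟨U, hU⟩ := (𝓝 (1 : G)).exists_antitone_basis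
  have hS : ∀ x, ∀ q ∈ Q, ‖k (q * x)‖ₑ ≤ ⨆ q ∈ Q, ‖k (q * x)‖ₑ := fun x q hq =>
    le_iSup₂ (f := fun (q : G) (_ : q ∈ Q) => ‖k (q * x)‖ₑ) q hq
  have hbound : ∀ᶠ n in Filter.atTop, ∀ᵐ y ∂μ, leftOsc k (U n) y ≤
      2 * ⨆ q ∈ Q, ‖k (q * y)‖ₑ := by
    filter_upwards [hU.eventually_subset (inv_mem_nhds_one G hQ)] with n hn
    refine Filter.Eventually.of_forall fun y => iSup₂_le fun u hu => ?_
    have h1 := hS y 1 (mem_of_mem_nhds hQ)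
    rw [one_mul] at h1
    rw [two_mul]
    exact enorm_sub_le.trans (add_le_add h1 (hS y u⁻¹ (hn hu)))
  have hlim : ∀ᵐ y ∂μ, Filter.Tendsto (fun n => leftOsc k (U n) y) Filter.atTop (𝓝 0) := by
    refine Filter.Eventually.of_forall fun y => ENNReal.tendsto_nhds_zero.2 fun δ hδ => ?_
    have hcy : Continuous fun u : G => ‖k y - k (u⁻¹ * y)‖ₑ := by fun_prop
    have hmem : {u : G | ‖k y - k (u⁻¹ * y)‖ₑ < δ} ∈ 𝓝 (1 : G) :=
      (isOpen_lt hcy continuous_const).mem_nhds (by simpa using hδ)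
    filter_upwards [hU.eventually_subset hmem] with n hn
    exact iSup₂_le fun u hu => (hn hu).le
  have := tendsto_lintegral_filter_of_dominated_convergence
    (fun y => 2 * ⨆ q ∈ Q, ‖k (q * y)‖ₑ) (Filter.Eventually.of_forall fun n =>
      measurable_leftOsc hc (U n)) hbound
    (by
      rw [lintegral_const_mul' _ _ (by simp)]
      exact (ENNReal.mul_lt_top (by simp) hfin).ne) hlim
  rw [lintegral_zero] at this
  obtain ⟨n, hn⟩ := (this.eventually (gt_mem_nhds hε)).exists
  exact ⟨U n, hU.1.mem_of_mem trivial, hn⟩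

/-- Maximal deviation of the coefficient of `f` along right translation by `U`. -/
def coeffOsc (μ : Measure G) (π : G →* unitary (H →L[ℂ] H)) (k : G → ℂ) (U : Set G) (g₀ f : H)
    (q : G ⧸ Subgroup.center G) : ℝ≥0∞ :=
  ∫⁻ y, leftOsc k U y * absCoeff π g₀ f (q * (y : G ⧸ Subgroup.center G)) ∂μ

/-- Left invariance gives `π(xu) g = ∫ k(u⁻¹y) π(xy) g₀ dy`, so moving by `u` only replaces `k` by
its left translate. -/
lemma enorm_coeff_sub_le [SecondCountableTopology G] {μ : Measure G} [μ.IsMulLeftInvariant]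
    {π : G →* unitary (H →L[ℂ] H)} (hc : IsStronglyContinuous π) (hπ : IsIrreducible π)
    {k : G → ℂ} (hk : Continuous k) (hki : Integrable k μ) {g g₀ : H}
    (hg : g = ∫ x, k x • (π x : H →L[ℂ] H) g₀ ∂μ) (f : H) {U : Set G} {u : G} (hu : u ∈ U)
    (x : G) : ‖coeff π g f x - coeff π g f (x * u)‖ₑ ≤ coeffOsc μ π k U g₀ f x := by
  have hint : ∀ (l : G → ℂ) (x : G), Continuous l → Integrable l μ →
      Integrable (fun y => l y • (π (x * y) : H →L[ℂ] H) g₀) μ := by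
    intro l x hl hli
    refine Integrable.mono' (hli.norm.mul_const ‖g₀‖)
      (hl.smul ((hc g₀).comp (continuous_const_mul x))).aestronglyMeasurable
      (Filter.Eventually.of_forall fun y => ?_)
    rw [norm_smul, norm_unitary_apply]
  have hpi : ∀ x, (π x : H →L[ℂ] H) g = ∫ y, k y • (π (x * y) : H →L[ℂ] H) g₀ ∂μ := by
    intro x
    have h1 := hint k 1 hk hki
    simp only [one_mul] at h1
    rw [hg, ← ContinuousLinearMap.integral_comp_comm _ h1]
    refine integral_congr_ae (Filter.Eventually.of_forall fun y => ?_)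
    simp only [map_smul, map_mul]
    rfl
  have hku : Integrable (fun y => k (u⁻¹ * y)) μ := hki.comp_mul_left u⁻¹
  have hkuc : Continuous (fun y => k (u⁻¹ * y)) := by fun_prop
  have hxu : (π (x * u) : H →L[ℂ] H) g =
      ∫ y, k (u⁻¹ * y) • (π (x * y) : H →L[ℂ] H) g₀ ∂μ := by
    rw [hpi, ← integral_mul_left_eq_self
      (fun y => k (u⁻¹ * y) • (π (x * y) : H →L[ℂ] H) g₀) u]
    simp only [inv_mul_cancel_left, mul_assoc]
  have hdiff : coeff π g f x - coeff π g f (x * u) =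
      conj (∫ y, inner ℂ f ((k y - k (u⁻¹ * y)) • (π (x * y) : H →L[ℂ] H) g₀) ∂μ) := by
    rw [integral_inner (hint (fun y => k y - k (u⁻¹ * y)) x (hk.sub hkuc) (hki.sub hku)), inner_conj_symm]
    simp only [coeff]
    rw [← inner_sub_left, hpi x, hxu, ← integral_sub (hint k x hk hki) (hint _ x hkuc hku)]
    simp only [sub_smul]
  rw [hdiff]
  have hconj : ∀ w : ℂ, ‖conj w‖ₑ = ‖w‖ₑ := fun w => by
    rw [← ofReal_norm, ← ofReal_norm, RCLike.norm_conj]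
  rw [hconj]
  refine (enorm_integral_le_lintegral_enorm _).trans (lintegral_mono fun y => ?_)
  rw [inner_smul_right, enorm_mul, ← QuotientGroup.mk_mul, hπ.absCoeff_mk]
  refine mul_le_mul' (le_iSup₂ (f := fun (u : G) (_ : u ∈ U) => ‖k y - k (u⁻¹ * y)‖ₑ) u hu) ?_
  rw [coeff, ← hconj, inner_conj_symm]

end Oscillation

end CoherentFrame

end Coefficients

/-! ### Sampling inequalities and the frame bounds. -/

noncomputable section Sampling

open scoped ENNReal

namespace CoherentFrame

/-- Cauchy–Schwarz for the factors `√h` and `√h · φ`. -/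
lemma sq_lintegral_mul_le {X : Type*} [MeasurableSpace X] (μ : Measure X) {h φ : X → ℝ≥0∞}
    (hh : AEMeasurable h μ) (hφ : AEMeasurable φ μ) :
    (∫⁻ x, h x * φ x ∂μ) ^ 2 ≤ (∫⁻ x, h x ∂μ) * ∫⁻ x, h x * φ x ^ 2 ∂μ := by
  have h1 := ENNReal.lintegral_mul_le_Lp_mul_Lq μ Real.HolderConjugate.two_two
    (hh.pow_const (1 / 2 : ℝ)) ((hh.pow_const (1 / 2 : ℝ)).mul hφ)
  have hsq : ∀ a : ℝ≥0∞, (a ^ (1 / 2 : ℝ)) ^ (2 : ℝ) = a := fun a => by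
    rw [← ENNReal.rpow_mul]; norm_num
  have hmul : ∀ a : ℝ≥0∞, a ^ (1 / 2 : ℝ) * a ^ (1 / 2 : ℝ) = a := fun a => by
    rw [← ENNReal.rpow_add_of_nonneg _ _ (by norm_num) (by norm_num)]; norm_num
  simp only [Pi.mul_apply, ← mul_assoc, hmul, hsq, ENNReal.mul_rpow_of_nonneg _ _ zero_le_two] at h1
  have h2 := pow_le_pow_left' h1 2
  rw [mul_pow, ← ENNReal.rpow_two ((∫⁻ x, h x ∂μ) ^ (1 / 2 : ℝ)),
    ← ENNReal.rpow_two ((∫⁻ x, h x * φ x ^ (2 : ℝ) ∂μ) ^ (1 / 2 : ℝ)), hsq, hsq] at h2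
  simpa only [ENNReal.rpow_two] using h2

lemma add_sq_le_two_mul (a b : ℝ≥0∞) : (a + b) ^ 2 ≤ 2 * a ^ 2 + 2 * b ^ 2 := by
  have := ENNReal.rpow_add_le_mul_rpow_add_rpow a b (p := 2) (by norm_num)
  norm_num at this
  rwa [mul_add] at this

lemma measure_smul_of_isMulLeftInvariant {B : Type*} [Group B] [MeasurableSpace B]
    [MeasurableMul B] {ν : Measure B} [ν.IsMulLeftInvariant] (l : B) (s : Set B) :
    ν (l • s) = ν s := by
  rw [← preimage_smul_inv]
  exact measure_preimage_mul ν l⁻¹ s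

section Group

variable {B : Type*} [Group B] [TopologicalSpace B] [IsTopologicalGroup B] [MeasurableSpace B]
  [OpensMeasurableSpace B] [MeasurableMul B]
  {ν : Measure B} [ν.IsMulLeftInvariant] {F M : B → ℝ≥0∞} {Λ U : Set B}

/-- Upper sampling inequality for a uniformly separated set. -/
lemma mul_tsum_le_of_separated (hF : Measurable F) (hΛ : Λ.Countable)
    (h1 : ∀ q, ∀ u ∈ U, F (q * u) ≤ F q + M q)
    {V : Set B} (hVo : IsOpen V) (hVU : V⁻¹ ⊆ U)
    (hsep : ∀ l ∈ Λ, ∀ l' ∈ Λ, ∀ v ∈ V, ∀ v' ∈ V, l * v = l' * v' → l = l') :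
    ν V * ∑' l : Λ, F l ^ 2 ≤ 2 * ∫⁻ q, F q ^ 2 ∂ν + 2 * ∫⁻ q, M q ^ 2 ∂ν := by
  have := hΛ.to_subtype
  rw [← ENNReal.tsum_mul_left]
  have hm : ∀ l : Λ, MeasurableSet ((l : B) • V) := fun l => (hVo.smul (l : B)).measurableSet
  have hd : Pairwise (Function.onFun Disjoint fun l : Λ => (l : B) • V) := by
    intro l l' hll
    refine Set.disjoint_left.2 ?_
    rintro _ ⟨v, hv, rfl⟩ ⟨v', hv', h⟩
    exact hll (Subtype.ext (hsep l l.2 l' l'.2 v hv v' hv' h.symm))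
  calc ∑' l : Λ, ν V * F l ^ 2
      ≤ ∑' l : Λ, ∫⁻ q in (l : B) • V, (2 * F q ^ 2 + 2 * M q ^ 2) ∂ν := by
        refine ENNReal.tsum_le_tsum fun l => ?_
        rw [← measure_smul_of_isMulLeftInvariant (l : B) V, mul_comm, ← setLIntegral_const]
        refine setLIntegral_mono' (hm l) fun q hq => ?_
        obtain ⟨v, hv, rfl⟩ := hq
        -- The base point is `l v` and the displacement `v⁻¹`, so the error `M` is evaluated at the
        -- integration variable and can be integrated.
        have := h1 ((l : B) * v) v⁻¹ (hVU (inv_mem_inv.2 hv))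
        rw [mul_inv_cancel_right] at this
        exact (pow_le_pow_left' this 2).trans (add_sq_le_two_mul _ _)
    _ = ∫⁻ q in ⋃ l : Λ, (l : B) • V, (2 * F q ^ 2 + 2 * M q ^ 2) ∂ν :=
        (lintegral_iUnion hm hd _).symm
    _ ≤ ∫⁻ q, (2 * F q ^ 2 + 2 * M q ^ 2) ∂ν := setLIntegral_le_lintegral _ _
    _ = _ := by
        rw [lintegral_add_left ((hF.pow_const 2).const_mul 2), lintegral_const_mul' _ _ (by simp),
          lintegral_const_mul' _ _ (by simp)]

/-- Lower sampling inequality for a dense set. -/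
lemma lintegral_sq_le_of_dense (hΛ : Λ.Countable)
    (h2 : ∀ q, ∀ u ∈ U, F q ≤ F (q * u) + M q) (hUo : IsOpen U) (hUinv : U⁻¹ = U)
    (hcov : ∀ q : B, ∃ l ∈ Λ, ∃ u ∈ U, l * u = q) :
    ∫⁻ q, F q ^ 2 ∂ν ≤ 2 * (ν U * ∑' l : Λ, F l ^ 2) + 2 * ∫⁻ q, M q ^ 2 ∂ν := by
  have := hΛ.to_subtype
  have hm : ∀ l : Λ, MeasurableSet ((l : B) • U) := fun l => (hUo.smul (l : B)).measurableSet
  have hme : ∀ l : Λ, Measurable (((l : B) • U).indicator fun _ : B => F l ^ 2) :=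
    fun l => measurable_const.indicator (hm l)
  calc ∫⁻ q, F q ^ 2 ∂ν
      ≤ ∫⁻ q, (2 * ∑' l : Λ, ((l : B) • U).indicator (fun _ => F l ^ 2) q + 2 * M q ^ 2) ∂ν := by
        refine lintegral_mono fun q => ?_
        obtain ⟨l, hl, u, hu, rfl⟩ := hcov q
        have h3 := h2 (l * u) u⁻¹ (by rw [← hUinv]; exact inv_mem_inv.2 hu)
        rw [mul_inv_cancel_right] at h3
        refine (pow_le_pow_left' h3 2).trans ((add_sq_le_two_mul _ _).trans ?_)
        gcongr
        refine le_trans ?_ (ENNReal.le_tsum (⟨l, hl⟩ : Λ))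
        rw [indicator_of_mem (show l * u ∈ l • U from ⟨u, hu, rfl⟩)]
    _ = _ := by
        rw [lintegral_add_left ((Measurable.tsum hme).const_mul 2),
          lintegral_const_mul' _ _ (by simp), lintegral_const_mul' _ _ (by simp),
          lintegral_tsum fun l => (hme l).aemeasurable]
        simp only [lintegral_indicator_const (hm _), measure_smul_of_isMulLeftInvariant, ENNReal.tsum_mul_right,
          mul_comm (ν U)]

end Group

lemma isCoherentFrame_of_tsum_absCoeff {G : Type*} [Group G] {H : Type*}
    [NormedAddCommGroup H] [InnerProductSpace ℂ H] [CompleteSpace H] {π : G →* unitary (H →L[ℂ] H)} (hπ : IsIrreducible π)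
    {g : H} {Λq : Set (G ⧸ Subgroup.center G)} {A C : ℝ} (hA : 0 < A) (hC : 0 < C)
    (hl : ∀ f : H, ENNReal.ofReal (A * ‖f‖ ^ 2) ≤ ∑' l : Λq, absCoeff π g f l ^ 2)
    (hu : ∀ f : H, ∑' l : Λq, absCoeff π g f l ^ 2 ≤ ENNReal.ofReal (C * ‖f‖ ^ 2))
    {Λ : Set G} (hΛ : BijOn (QuotientGroup.mk : G → G ⧸ Subgroup.center G) Λ Λq) :
    IsCoherentFrame π g Λ := by
  refine ⟨A, C, hA, hC, fun f => ?_⟩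
  have hsum : ∑' l : Λq, absCoeff π g f l ^ 2 =
      ∑' l : Λ, ENNReal.ofReal (‖coeff π g f l‖ ^ 2) := by
    rw [← (hΛ.equiv _).tsum_eq]
    refine tsum_congr fun l => ?_
    change absCoeff π g f ((l : G) : G ⧸ Subgroup.center G) ^ 2 = _
    rw [hπ.absCoeff_mk, ENNReal.ofReal_pow (norm_nonneg _), ofReal_norm]
  have hl := hl f
  have hu := hu f
  rw [hsum] at hl hu
  have hs : Summable fun l : Λ => ‖coeff π g f l‖ ^ 2 := by
    have := ENNReal.summable_toReal (hu.trans_lt ENNReal.ofReal_lt_top).ne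
    simpa only [ENNReal.toReal_ofReal (sq_nonneg _)] using this
  rw [← ENNReal.ofReal_tsum_of_nonneg (fun l => sq_nonneg _) hs] at hl hu
  refine ⟨hs, ?_, ?_⟩
  · exact (ENNReal.ofReal_le_ofReal_iff (tsum_nonneg fun l => sq_nonneg _)).1 hl
  · exact (ENNReal.ofReal_le_ofReal_iff (by positivity)).1 hu

lemma opensMeasurableSpace_quotient_center {G : Type*} [Group G] [TopologicalSpace G]
    [MeasurableSpace G] [BorelSpace G] : OpensMeasurableSpace (G ⧸ Subgroup.center G) := by
  refine ⟨MeasurableSpace.generateFrom_le fun s hs => ?_⟩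
  exact measurableSet_quotient.2
    (hs.preimage (QuotientGroup.isQuotientMap_mk (Subgroup.center G)).continuous).measurableSet

variable {G : Type*} [Group G] [TopologicalSpace G] [IsTopologicalGroup G]
  [MeasurableSpace G] [BorelSpace G]

lemma measurableMul_quotient_center : MeasurableMul (G ⧸ Subgroup.center G) := by
  constructor
  · intro q
    induction q using QuotientGroup.induction_on with
    | H x =>
      refine measurable_from_quotient.2 ?_
      exact measurable_quotient_mk''.comp (measurable_const_mul x)
  · intro q
    induction q using QuotientGroup.induction_on with
    | H x =>
      refine measurable_from_quotient.2 ?_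
      exact measurable_quotient_mk''.comp (measurable_mul_const x)

variable [SecondCountableTopology G] {H : Type*} [NormedAddCommGroup H] [InnerProductSpace ℂ H]
  [CompleteSpace H]

/-- After Cauchy–Schwarz and Tonelli, the inner integral at fixed `y` is that of a coefficient with
window `π(y) g₀`, whose norm is `‖g₀‖`; orthogonality evaluates it independently of `y`. -/
lemma lintegral_coeffOsc_sq_le {μ : Measure G} [SFinite μ]
    {ν : Measure (G ⧸ Subgroup.center G)} [SFinite ν]
    {π : G →* unitary (H →L[ℂ] H)} (hc : IsStronglyContinuous π) (hπ : IsIrreducible π) {d : ℝ}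
    (hd : ∀ g f : H, ∫⁻ q, absCoeff π g f q ^ 2 ∂ν = ENNReal.ofReal (d * ‖f‖ ^ 2 * ‖g‖ ^ 2))
    {k : G → ℂ} (hk : Continuous k) (U : Set G) (g₀ f : H) :
    ∫⁻ q, coeffOsc μ π k U g₀ f q ^ 2 ∂ν ≤
      (∫⁻ y, leftOsc k U y ∂μ) ^ 2 * ENNReal.ofReal (d * ‖f‖ ^ 2 * ‖g₀‖ ^ 2) := by
  have := opensMeasurableSpace_quotient_center (G := G)
  have hmk : Continuous (QuotientGroup.mk : G → G ⧸ Subgroup.center G) :=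
    (QuotientGroup.isQuotientMap_mk (Subgroup.center G)).continuous
  have habs := continuous_absCoeff hc hπ g₀ f
  have hh := measurable_leftOsc hk U
  have hcont : Continuous fun p : (G ⧸ Subgroup.center G) × G =>
      absCoeff π g₀ f (p.1 * (p.2 : G ⧸ Subgroup.center G)) :=
    habs.comp (continuous_fst.mul (hmk.comp continuous_snd))
  calc ∫⁻ q, coeffOsc μ π k U g₀ f q ^ 2 ∂ν
      ≤ ∫⁻ q, (∫⁻ y, leftOsc k U y ∂μ) * ∫⁻ y, leftOsc k U y *
          absCoeff π g₀ f (q * (y : G ⧸ Subgroup.center G)) ^ 2 ∂μ ∂ν := by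
        refine lintegral_mono fun q => sq_lintegral_mul_le μ hh.aemeasurable ?_
        exact (habs.comp (continuous_const.mul hmk)).measurable.aemeasurable
    _ = (∫⁻ y, leftOsc k U y ∂μ) * ∫⁻ y, leftOsc k U y *
          ENNReal.ofReal (d * ‖f‖ ^ 2 * ‖g₀‖ ^ 2) ∂μ := by
        have hj : Measurable fun p : (G ⧸ Subgroup.center G) × G => leftOsc k U p.2 *
            absCoeff π g₀ f (p.1 * (p.2 : G ⧸ Subgroup.center G)) ^ 2 :=
          (hh.comp measurable_snd).mul (hcont.measurable.pow_const 2)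
        rw [lintegral_const_mul _ hj.lintegral_prod_right', lintegral_lintegral_swap
          hj.aemeasurable]
        congr 1
        refine lintegral_congr fun y => ?_
        have hy : Measurable fun q : G ⧸ Subgroup.center G =>
            absCoeff π g₀ f (q * (y : G ⧸ Subgroup.center G)) ^ 2 :=
          (habs.comp (continuous_mul_const _)).measurable.pow_const 2
        dsimp only
        rw [lintegral_const_mul _ hy]
        simp only [hπ.absCoeff_mul_mk, hd, norm_unitary_apply]
    _ = _ := by
        rw [lintegral_mul_const _ hh, ← mul_assoc, ← sq]

lemma absCoeff_mul_le {μ : Measure G} [μ.IsMulLeftInvariant]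
    {π : G →* unitary (H →L[ℂ] H)} (hc : IsStronglyContinuous π) (hπ : IsIrreducible π)
    {k : G → ℂ} (hk : MemAmalgam μ k) {g g₀ : H}
    (hg : g = ∫ x, k x • (π x : H →L[ℂ] H) g₀ ∂μ) (f : H) (U : Set G)
    (q u : G ⧸ Subgroup.center G)
    (hu : u ∈ (QuotientGroup.mk : G → G ⧸ Subgroup.center G) '' U) :
    absCoeff π g f (q * u) ≤ absCoeff π g f q + coeffOsc μ π k U g₀ f q ∧
      absCoeff π g f q ≤ absCoeff π g f (q * u) + coeffOsc μ π k U g₀ f q := by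
  obtain ⟨u, hu, rfl⟩ := hu
  induction q using QuotientGroup.induction_on with
  | H x =>
    have h := enorm_coeff_sub_le hc hπ hk.1 hk.integrable hg f hu x
    rw [← QuotientGroup.mk_mul, hπ.absCoeff_mk, hπ.absCoeff_mk]
    constructor
    · rw [enorm_sub_rev] at h
      calc _ = ‖coeff π g f x + (coeff π g f (x * u) - coeff π g f x)‖ₑ := by
            rw [add_sub_cancel]
        _ ≤ _ := (enorm_add_le _ _).trans (by gcongr)
    · calc _ = ‖coeff π g f (x * u) + (coeff π g f x - coeff π g f (x * u))‖ₑ := by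
            rw [add_sub_cancel]
        _ ≤ _ := (enorm_add_le _ _).trans (by gcongr)

/-- Coherent frames over sets of translations that tile `G / Z` finely enough. -/
theorem exists_quasiLattice_isCoherentFrame [T2Space G] [LocallyCompactSpace G]
    (hG : HasSmallTilings (⊤ : Subgroup (G ⧸ Subgroup.center G)))
    (μ : Measure G) [μ.IsHaarMeasure]
    (ν : Measure (G ⧸ Subgroup.center G)) [ν.IsHaarMeasure]
    (π : G →* unitary (H →L[ℂ] H)) (hc : IsStronglyContinuous π) (hπ : IsIrreducible π)
    (hsq : IsSquareIntegrableModCenter ν π) {g : H} (hg : IsNice μ π g) (hg0 : g ≠ 0) :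
    ∃ Λq : Set (G ⧸ Subgroup.center G), IsQuasiLattice Λq ∧
      ∀ Λ : Set G, BijOn (QuotientGroup.mk : G → G ⧸ Subgroup.center G) Λ Λq →
        IsCoherentFrame π g Λ := by
  have := opensMeasurableSpace_quotient_center (G := G)
  have := measurableMul_quotient_center (G := G)
  have : T2Space (G ⧸ Subgroup.center G) := by
    have : IsClosed (Subgroup.center G : Set G) := by
      rw [← Subgroup.centralizer_univ]
      exact Set.isClosed_centralizer _
    infer_instance
  have hmkc : Continuous (QuotientGroup.mk : G → G ⧸ Subgroup.center G) :=
    (QuotientGroup.isQuotientMap_mk (Subgroup.center G)).continuous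
  obtain ⟨g₀, k, hk, hg⟩ := hg
  replace hk : MemAmalgam μ k := hk.elim (fun h => memAmalgam_of_hasCompactSupport h.1 h.2) id
  obtain ⟨d, hd0, hd⟩ := hsq.exists_lintegral_absCoeff_sq
  have hgpos : 0 < ‖g‖ := norm_pos_iff.2 hg0
  -- Chosen so that `r ‖g₀‖ ≤ ‖g‖ / 2`, which makes the squared error at most a quarter of `‖V f‖²`.
  -- The `+ 1` keeps the denominator positive without discussing `g₀`.
  set r : ℝ := ‖g‖ / (2 * (‖g₀‖ + 1)) with hr
  have hr0 : 0 < r := by positivity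
  have hrg : r ^ 2 * ‖g₀‖ ^ 2 ≤ ‖g‖ ^ 2 / 4 := by
    have h1 : r * ‖g₀‖ ≤ ‖g‖ / 2 := by
      rw [hr, div_mul_eq_mul_div, div_le_div_iff₀ (by positivity) two_pos]
      nlinarith [norm_nonneg g₀]
    calc r ^ 2 * ‖g₀‖ ^ 2 = (r * ‖g₀‖) ^ 2 := by ring
      _ ≤ (‖g‖ / 2) ^ 2 := pow_le_pow_left₀ (by positivity) h1 2
      _ = _ := by ring
  obtain ⟨U₀, hU₀, hU₀r⟩ := hk.exists_lintegral_leftOsc_lt (ENNReal.ofReal_pos.2 hr0)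
  obtain ⟨Q, hQc, hQ⟩ := exists_compact_mem_nhds (1 : G)
  -- Symmetry permits displacement by inverses; containment in the compact `Q` gives finite measure
  -- and a relatively compact fundamental domain.
  set U : Set G := interior (U₀ ∩ Q) ∩ (interior (U₀ ∩ Q))⁻¹ with hU
  have h1i : (1 : G) ∈ interior (U₀ ∩ Q) :=
    mem_interior_iff_mem_nhds.2 (Filter.inter_mem hU₀ hQ)
  have hUo : IsOpen U := isOpen_interior.inter isOpen_interior.inv
  have h1U : (1 : G) ∈ U := ⟨h1i, by simpa using h1i⟩
  have hUU₀ : U ⊆ U₀ := fun x hx => (interior_subset hx.1).1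
  have hUQ : U ⊆ Q := fun x hx => (interior_subset hx.1).2
  have hUinv : U⁻¹ = U := by rw [hU, inter_inv, inv_inv, inter_comm]
  set Ub : Set (G ⧸ Subgroup.center G) := (QuotientGroup.mk : G → _) '' U with hUb
  have hUbo : IsOpen Ub := QuotientGroup.isOpenMap_coe _ hUo
  have h1Ub : Ub ∈ 𝓝 (1 : G ⧸ Subgroup.center G) := hUbo.mem_nhds ⟨1, h1U, rfl⟩
  have hUbinv : Ub⁻¹ = Ub := by
    conv_rhs => rw [hUb, ← hUinv]
    exact (image_inv (QuotientGroup.mk' (Subgroup.center G)) U).symm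
  have hQb : IsCompact ((QuotientGroup.mk : G → G ⧸ Subgroup.center G) '' Q) := hQc.image hmkc
  have hUbQ : Ub ⊆ (QuotientGroup.mk : G → G ⧸ Subgroup.center G) '' Q := image_mono hUQ
  obtain ⟨Λ, K, -, -, hKU, hex, huniq, V₁, hV₁, hsep⟩ := hG Ub h1Ub
  obtain ⟨V₂, hV₂, hVV⟩ := exists_nhds_split_inv hV₁
  set V : Set (G ⧸ Subgroup.center G) := interior V₂ ∩ Ub with hV
  have hVo : IsOpen V := isOpen_interior.inter hUbo
  have h1V : (1 : G ⧸ Subgroup.center G) ∈ V :=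
    ⟨mem_interior_iff_mem_nhds.2 hV₂, mem_of_mem_nhds h1Ub⟩
  have hVU : V⁻¹ ⊆ Ub := by
    rw [← hUbinv]
    exact inv_subset_inv.2 inter_subset_right
  have hVsep : ∀ l ∈ Λ, ∀ l' ∈ Λ, ∀ v ∈ V, ∀ v' ∈ V, l * v = l' * v' → l = l' := by
    intro l hl l' hl' v hv v' hv' h
    refine hsep l hl l' hl' ?_
    have h1 : l⁻¹ * l' = v / v' := by
      rw [div_eq_mul_inv, inv_mul_eq_iff_eq_mul, ← mul_assoc, h, mul_inv_cancel_right]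
    rw [h1]
    exact hVV v (interior_subset hv.1) v' (interior_subset hv'.1)
  have hΛc : Λ.Countable := by
    refine Set.PairwiseDisjoint.countable_of_isOpen (s := fun l => l • V) ?_
      (fun l _ => hVo.smul l) (fun l _ => ⟨l • 1, 1, h1V, rfl⟩)
    intro l hl l' hl' hll
    refine Set.disjoint_left.2 ?_
    rintro _ ⟨v, hv, rfl⟩ ⟨v', hv', h⟩
    exact hll (hVsep l hl l' hl' v hv v' hv' h.symm)
  have hfin : ∀ s ⊆ Ub, ν s ≠ ⊤ := fun s hs =>
    ((measure_mono (hs.trans hUbQ)).trans_lt hQb.measure_lt_top).ne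
  have hpos : ∀ s : Set (G ⧸ Subgroup.center G), IsOpen s → 1 ∈ s → s ⊆ Ub →
      0 < (ν s).toReal := fun s hs h1 hsU =>
    ENNReal.toReal_pos (hs.measure_pos ν ⟨1, h1⟩).ne' (hfin s hsU)
  set a : ℝ := (ν Ub).toReal with ha
  set b : ℝ := (ν V).toReal with hb
  have ha0 : 0 < a := hpos Ub hUbo (mem_of_mem_nhds h1Ub) subset_rfl
  have hb0 : 0 < b := hpos V hVo h1V inter_subset_right
  have hνa : ν Ub = ENNReal.ofReal a := (ENNReal.ofReal_toReal (hfin Ub subset_rfl)).symm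
  have hνb : ν V = ENNReal.ofReal b := (ENNReal.ofReal_toReal (hfin V inter_subset_right)).symm
  have hM : ∀ f : H, ∫⁻ q, coeffOsc μ π k U g₀ f q ^ 2 ∂ν ≤
      ENNReal.ofReal (d * ‖f‖ ^ 2 * ‖g‖ ^ 2 / 4) := by
    intro f
    have h1 : ∫⁻ y, leftOsc k U y ∂μ ≤ ENNReal.ofReal r :=
      (lintegral_mono fun y => leftOsc_mono hUU₀ y).trans hU₀r.le
    calc _ ≤ _ := lintegral_coeffOsc_sq_le hc hπ hd hk.1 U g₀ f
      _ ≤ ENNReal.ofReal r ^ 2 * ENNReal.ofReal (d * ‖f‖ ^ 2 * ‖g₀‖ ^ 2) := by gcongr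
      _ = ENNReal.ofReal (d * ‖f‖ ^ 2 * (r ^ 2 * ‖g₀‖ ^ 2)) := by
        rw [← ENNReal.ofReal_pow hr0.le, ← ENNReal.ofReal_mul (by positivity)]
        congr 1; ring
      _ ≤ ENNReal.ofReal (d * ‖f‖ ^ 2 * (‖g‖ ^ 2 / 4)) := by gcongr
      _ = _ := by congr 1; ring
  -- The factor `5 / 2` is `2 + 2 · (1/4)`.
  have hup : ∀ f : H, ∑' l : Λ, absCoeff π g f l ^ 2 ≤
      ENNReal.ofReal (5 / 2 * d * ‖g‖ ^ 2 / b * ‖f‖ ^ 2) := by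
    intro f
    have h := mul_tsum_le_of_separated (ν := ν) (continuous_absCoeff hc hπ g f).measurable hΛc
      (fun q u hu => (absCoeff_mul_le hc hπ hk hg f U q u hu).1) hVo hVU hVsep
    rw [hd] at h
    have h2 : ENNReal.ofReal b * ∑' l : Λ, absCoeff π g f l ^ 2 ≤
        ENNReal.ofReal (5 / 2 * d * ‖g‖ ^ 2 * ‖f‖ ^ 2) := by
      rw [← hνb]
      refine h.trans ((add_le_add_right (mul_le_mul_right (hM f) 2) _).trans_eq ?_)
      rw [← ENNReal.ofReal_ofNat 2, ← ENNReal.ofReal_mul (by norm_num),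
        ← ENNReal.ofReal_mul (by norm_num), ← ENNReal.ofReal_add (by positivity) (by positivity)]
      congr 1; ring
    rw [mul_comm, ← ENNReal.le_div_iff_mul_le (Or.inl (ENNReal.ofReal_pos.2 hb0).ne')
      (Or.inl ENNReal.ofReal_ne_top), ← ENNReal.ofReal_div_of_pos hb0] at h2
    refine h2.trans_eq ?_
    congr 1; ring
  have hlow : ∀ f : H, ENNReal.ofReal (d * ‖g‖ ^ 2 / (4 * a) * ‖f‖ ^ 2) ≤
      ∑' l : Λ, absCoeff π g f l ^ 2 := by
    intro f
    have h := lintegral_sq_le_of_dense (ν := ν) hΛc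
      (fun q u hu => (absCoeff_mul_le hc hπ hk hg f U q u hu).2) hUbo hUbinv
      (fun q => by
        obtain ⟨l, hl, k, hk, h⟩ := hex q (Subgroup.mem_top q)
        exact ⟨l, hl, k, hKU hk, h⟩)
    -- Finiteness of the sum lets the inequality pass to `ℝ`, where the error, half of the left
    -- side, is absorbed; what remains is `½ d ‖f‖² ‖g‖² ≤ 2 a ∑`.
    have hS := ((hup f).trans_lt ENNReal.ofReal_lt_top).ne
    rw [hd, hνa] at h
    have h2 := h.trans (add_le_add_right (mul_le_mul_right (hM f) 2) _)
    rw [← ENNReal.ofReal_toReal hS, ← ENNReal.ofReal_ofNat 2, ← ENNReal.ofReal_mul ha0.le,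
      ← ENNReal.ofReal_mul (by norm_num), ← ENNReal.ofReal_mul (by norm_num),
      ← ENNReal.ofReal_add (by positivity) (by positivity),
      ENNReal.ofReal_le_ofReal_iff (by positivity)] at h2
    rw [← ENNReal.ofReal_toReal hS]
    refine ENNReal.ofReal_le_ofReal ?_
    rw [div_mul_eq_mul_div, div_le_iff₀ (by positivity)]
    linarith
  refine ⟨Λ, ⟨K, hQb.closure_of_subset (hKU.trans hUbQ), ?_, ?_⟩, fun Λ' hΛ' =>
    isCoherentFrame_of_tsum_absCoeff hπ (by positivity) (by positivity) hlow hup hΛ'⟩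
  · refine eq_univ_of_forall fun q => ?_
    obtain ⟨l, hl, k, hk, h⟩ := hex q (Subgroup.mem_top q)
    exact mem_iUnion₂.2 ⟨l, hl, k, hk, h⟩
  · intro l hl l' hl' hll
    refine Set.disjoint_left.2 ?_
    rintro _ ⟨v, hv, rfl⟩ ⟨v', hv', h⟩
    exact hll (huniq l hl l' hl' v hv v' hv' h.symm)

end CoherentFrame

end Sampling

theorem mainTheorem6
    {E : Type*} [NormedAddCommGroup E] [NormedSpace ℝ E] [FiniteDimensional ℝ E]
    {G : Type*} [Group G] [TopologicalSpace G] [T2Space G] [SecondCountableTopology G]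
    [ChartedSpace E G] [LieGroup 𝓘(ℝ, E) ∞ G] [SimplyConnectedSpace G] [Group.IsNilpotent G]
    [MeasurableSpace G] [BorelSpace G]
    (μ : Measure G) [μ.IsHaarMeasure]
    (ν : Measure (G ⧸ Subgroup.center G)) [ν.IsHaarMeasure]
    {H : Type*} [NormedAddCommGroup H] [InnerProductSpace ℂ H] [CompleteSpace H]
    (π : G →* unitary (H →L[ℂ] H))
    (hcont : CoherentFrame.IsStronglyContinuous π)
    (hirr : CoherentFrame.IsIrreducible π)
    (hsq : CoherentFrame.IsSquareIntegrableModCenter ν π)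
    (g : H) (hg : CoherentFrame.IsNice μ π g) (hg0 : g ≠ 0) :
    ∃ Λq : Set (G ⧸ Subgroup.center G), CoherentFrame.IsQuasiLattice Λq ∧
      ∀ Λ : Set G, BijOn (QuotientGroup.mk : G → G ⧸ Subgroup.center G) Λ Λq →
        CoherentFrame.IsCoherentFrame π g Λ := by
  have := topologicalGroup_of_lieGroup 𝓘(ℝ, E) ∞ (G := G)
  have := Manifold.locallyCompact_of_finiteDimensional (M := G) 𝓘(ℝ, E)
  exact CoherentFrame.exists_quasiLattice_isCoherentFrame
    (CoherentFrame.hasSmallTilings_quotient_center (E := E)) μ ν π hcont hirr hsq hg hg0
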